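/- Let $A^2$ be the Bergman space of the unit disk $\mathbb{D}$, that is, the closed subspace of $L^2(\mathbb{D},dA)$ consisting of the analytic functions, where $dA$ is the normalized area measure, and let $\tilde P$ be the orthogonal projection of $L^2(\mathbb{D},dA)$ onto $A^2$. For $u\in L^\infty(\mathbb{D})$ let $\tilde T_u h=\tilde P(uh)$, $h\in A^2$, be the Bergman Toeplitz operator with symbol $u$. For a bounded operator $A$ on a Hilbert space $H$, the range space $\mathcal{M}(A)$ is the vector space $AH$ with the inner product $\langle Af,Ag\rangle_{\mathcal{M}(A)}=\langle f,g\rangle_H$ for $f,g\in H\ominus\ker A$. For $b$ in the closed unit ball of $H^\infty(\mathbb{D})$, that is, $b$ analytic in $\mathbb{D}$ with $|b|\le 1$, the sub-Bergman spaces are the range spaces $$\mathcal{A}(b)=(I-\tilde T_b\tilde T_{\bar b})^{1/2}A^2,\qquad \mathcal{A}(\bar b)=(I-\tilde T_{\bar b}\tilde T_b)^{1/2}A^2 .$$ **Theorem.** Let $b$ be in the closed unit ball of $H^\infty(\mathbb{D})$. 1. The set of polynomials that belong to $\mathcal{A}(b)$ is dense in $\mathcal{A}(b)$, and the set of polynomials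 that belong to $\mathcal{A}(\bar b)$ is dense in $\mathcal{A}(\bar b)$, each with respect to the range-space norm. 2. If $b$ is not a constant of modulus $1$, then every polynomial belongs to $\mathcal{A}(b)$ and to $\mathcal{A}(\bar b)$. (If $b$ is a constant of modulus $1$, both spaces are $\{0\}$.) 3. $\mathcal{A}(b)=\mathcal{A}(\bar b)$ as sets, with equivalent norms: $\|f\|_{\mathcal{A}(b)}\le\|f\|_{\mathcal{A}(\bar b)}\le\sqrt2\,\|f\|_{\mathcal{A}(b)}$ for every $f$ in this space. -/

import Mathlib

noncomputable section

open MeasureTheory Metric Set Filter Topology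
open scoped ENNReal

/-! ### Range spaces of bounded operators -/

section RangeSpace

/-- The range space `𝓜(A) = A H` of a bounded operator `A` on a Hilbert space `H`. It is a type of
its own, so that it does not inherit the topology of `H`; its inner product is defined below. -/
def RangeSpace {H : Type*} [NormedAddCommGroup H] [InnerProductSpace ℂ H] (A : H →L[ℂ] H) :
    Type _ :=
  ↥(LinearMap.range (A : H →ₗ[ℂ] H))

namespace RangeSpace

variable {H : Type*} [NormedAddCommGroup H] [InnerProductSpace ℂ H] (A : H →L[ℂ] H)

instance : AddCommGroup (RangeSpace A) :=
  inferInstanceAs (AddCommGroup ↥(LinearMap.range (A : H →ₗ[ℂ] H)))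

instance : Module ℂ (RangeSpace A) :=
  inferInstanceAs (Module ℂ ↥(LinearMap.range (A : H →ₗ[ℂ] H)))

/-- The inclusion of `𝓜(A)` in `H`. -/
def incl : RangeSpace A →ₗ[ℂ] H :=
  (LinearMap.range (A : H →ₗ[ℂ] H)).subtype

/-- The map `f ↦ A f` onto the range space. -/
def map : H →ₗ[ℂ] RangeSpace A :=
  (A : H →ₗ[ℂ] H).rangeRestrict

theorem incl_map (f : H) : incl A (map A f) = A f := rfl

theorem incl_injective : Function.Injective (incl A) := Subtype.val_injective

theorem map_eq_zero_iff (f : H) : map A f = 0 ↔ A f = 0 := by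
  rw [← (incl_injective A).eq_iff, incl_map, map_zero]

variable [CompleteSpace H]

theorem map_bijective_on_orthogonal_ker :
    Function.Bijective
      ((map A).comp ((LinearMap.ker (A : H →ₗ[ℂ] H))ᗮ).subtype) := by
  have hc : CompleteSpace (LinearMap.ker (A : H →ₗ[ℂ] H)) :=
    (ContinuousLinearMap.isClosed_ker A).completeSpace_coe
  constructor
  · rw [← LinearMap.ker_eq_bot, LinearMap.ker_eq_bot']
    rintro ⟨x, hx⟩ h
    have h0 : A x = 0 := (map_eq_zero_iff A x).1 h
    have := Submodule.inner_right_of_mem_orthogonal (K := LinearMap.ker (A : H →ₗ[ℂ] H))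
      (u := x) (v := x) h0 hx
    exact Subtype.ext (inner_self_eq_zero.1 this)
  · rintro ⟨y, x, rfl⟩
    obtain ⟨k, hk, m, hm, rfl⟩ :=
      (LinearMap.ker (A : H →ₗ[ℂ] H)).exists_add_mem_mem_orthogonal x
    refine ⟨⟨m, hm⟩, incl_injective A ?_⟩
    have h0 : A k = 0 := hk
    change A m = A (k + m)
    rw [map_add, h0, zero_add]

/-- `A` as a linear isomorphism of `H ⊖ ker A` onto the range space. -/
def equiv : ↥((LinearMap.ker (A : H →ₗ[ℂ] H))ᗮ) ≃ₗ[ℂ] RangeSpace A :=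
  LinearEquiv.ofBijective _ (map_bijective_on_orthogonal_ker A)

/-- The unique preimage under `A`, in `H ⊖ ker A`, of an element of the range space. -/
def preimage : RangeSpace A →ₗ[ℂ] H :=
  ((LinearMap.ker (A : H →ₗ[ℂ] H))ᗮ).subtype.comp (equiv A).symm.toLinearMap

theorem preimage_injective : Function.Injective (preimage A) :=
  Subtype.val_injective.comp (equiv A).symm.injective

/-- The norm of the range space: `‖A f‖ = ‖f‖` for `f ∈ H ⊖ ker A`. -/
instance : NormedAddCommGroup (RangeSpace A) :=
  NormedAddCommGroup.induced (RangeSpace A) H (preimage A) (preimage_injective A)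

/-- The inner product of the range space: `⟪A f, A g⟫ = ⟪f, g⟫` for `f, g ∈ H ⊖ ker A`. -/
instance : InnerProductSpace ℂ (RangeSpace A) :=
  InnerProductSpace.induced (preimage A)

theorem inner_map_map {f g : H} (hf : f ∈ (LinearMap.ker (A : H →ₗ[ℂ] H))ᗮ)
    (hg : g ∈ (LinearMap.ker (A : H →ₗ[ℂ] H))ᗮ) :
    inner ℂ (map A f) (map A g) = inner ℂ f g := by
  have h : ∀ x (hx : x ∈ (LinearMap.ker (A : H →ₗ[ℂ] H))ᗮ), preimage A (map A x) = x :=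
    fun x hx ↦ congrArg Subtype.val ((equiv A).symm_apply_apply ⟨x, hx⟩)
  change inner ℂ (preimage A (map A f)) (preimage A (map A g)) = _
  rw [h f hf, h g hg]

end RangeSpace

end RangeSpace

/-- The positive square root of a positive operator on a complex Hilbert space. -/
def positiveSqrt {H : Type*} [NormedAddCommGroup H] [InnerProductSpace ℂ H] [CompleteSpace H]
    (A : H →L[ℂ] H) : H →L[ℂ] H :=
  CFC.sqrt A

theorem positiveSqrt_mul_self {H : Type*} [NormedAddCommGroup H] [InnerProductSpace ℂ H]
    [CompleteSpace H] {A : H →L[ℂ] H} (hA : A.IsPositive) :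
    positiveSqrt A * positiveSqrt A = A :=
  CFC.sqrt_mul_sqrt_self A (A.nonneg_iff_isPositive.2 hA)

theorem isPositive_positiveSqrt {H : Type*} [NormedAddCommGroup H] [InnerProductSpace ℂ H]
    [CompleteSpace H] (A : H →L[ℂ] H) : (positiveSqrt A).IsPositive :=
  (positiveSqrt A).nonneg_iff_isPositive.1 (CFC.sqrt_nonneg A)

/-! ### The Bergman space of the unit disk -/

namespace Bergman

/-- The normalized Lebesgue area measure `dA` of the unit disk. -/
def areaMeasure : Measure ℂ :=
  (volume (ball (0 : ℂ) 1))⁻¹ • volume.restrict (ball (0 : ℂ) 1)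

instance : IsProbabilityMeasure areaMeasure := by
  refine ⟨?_⟩
  rw [areaMeasure, Measure.smul_apply, Measure.restrict_apply_univ, smul_eq_mul]
  exact ENNReal.inv_mul_cancel (measure_ball_pos _ _ one_pos).ne' measure_ball_lt_top.ne

theorem ae_mem_ball : ∀ᵐ z ∂areaMeasure, z ∈ ball (0 : ℂ) 1 :=
  Measure.ae_smul_measure (ae_restrict_mem measurableSet_ball) _

theorem aestronglyMeasurable_of_continuousOn {f : ℂ → ℂ} (hf : ContinuousOn f (ball 0 1)) :
    AEStronglyMeasurable f areaMeasure :=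
  (hf.aestronglyMeasurable measurableSet_ball).smul_measure _

theorem enorm_sq_le_lintegral_circle {f : ℂ → ℂ} {w : ℂ} {R ρ : ℝ} (h0 : 0 < ρ) (h1 : ρ < R)
    (hf : DifferentiableOn ℂ f (ball w R)) :
    ENNReal.ofReal (2 * Real.pi) * ‖f w‖ₑ ^ 2 ≤
      ∫⁻ θ in Ioo (-Real.pi) Real.pi, ‖f (circleMap w ρ θ)‖ₑ ^ 2 := by
  have hd : DiffContOnCl ℂ (fun z ↦ f z ^ 2) (ball w |ρ|) := by
    refine ((hf.pow 2).mono ?_).diffContOnCl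
    rw [abs_of_pos h0, closure_ball _ h0.ne']
    exact closedBall_subset_ball h1
  have h2 := hd.circleAverage
  have hper : Function.Periodic (fun θ ↦ f (circleMap w ρ θ) ^ 2) (2 * Real.pi) := fun θ ↦ by
    simp only [periodic_circleMap w ρ θ]
  have h3 : ∫ θ in Ioo (-Real.pi) Real.pi, f (circleMap w ρ θ) ^ 2 = (2 * Real.pi) • f w ^ 2 := by
    rw [← h2, Real.circleAverage, smul_smul, mul_inv_cancel₀ (by positivity), one_smul,
      ← integral_Ioc_eq_integral_Ioo, ← intervalIntegral.integral_of_le (by linarith [Real.pi_pos])]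
    have := hper.intervalIntegral_add_eq (-Real.pi) 0
    rw [show -Real.pi + 2 * Real.pi = Real.pi by ring, zero_add] at this
    exact this
  have h4 := enorm_integral_le_lintegral_enorm (μ := volume.restrict (Ioo (-Real.pi) Real.pi))
    (fun θ ↦ f (circleMap w ρ θ) ^ 2)
  rw [h3, enorm_smul, Real.enorm_of_nonneg (by positivity)] at h4
  simpa only [enorm_pow] using h4

theorem enorm_sq_le_lintegral_ball {f : ℂ → ℂ} {w : ℂ} {R : ℝ} (hR : 0 < R)
    (hf : DifferentiableOn ℂ f (ball w R)) :
    ENNReal.ofReal (R / 2) * ENNReal.ofReal (R / 2) * ‖f w‖ₑ ^ 2 ≤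
      ∫⁻ z in ball w R, ‖f z‖ₑ ^ 2 := by
  have hm : ∀ p : ℝ × ℝ, w + Complex.polarCoord.symm p = circleMap w p.1 p.2 := fun p ↦ by
    simp [circleMap, Complex.exp_mul_I]
  have hsub : Ioo (R / 2) R ×ˢ Ioo (-Real.pi) Real.pi ⊆ polarCoord.target := by
    rintro ⟨a, b⟩ ⟨ha, hb⟩
    exact ⟨lt_trans (by linarith) ha.1, hb⟩
  have hmem : ∀ p ∈ Ioo (R / 2) R ×ˢ Ioo (-Real.pi) Real.pi, circleMap w p.1 p.2 ∈ ball w R := by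
    rintro ⟨a, b⟩ ⟨ha, hb⟩
    have : 0 < a := lt_trans (by linarith) ha.1
    simp [circleMap, dist_eq_norm, abs_of_pos this, ha.2]
  have hcm : Continuous (fun p : ℝ × ℝ ↦ circleMap w p.1 p.2) := by
    unfold circleMap; fun_prop
  have hcont : ContinuousOn (fun p : ℝ × ℝ ↦ ‖f (circleMap w p.1 p.2)‖ₑ ^ 2)
      (Ioo (R / 2) R ×ˢ Ioo (-Real.pi) Real.pi) := by
    have := (hf.continuousOn.comp hcm.continuousOn hmem)
    exact (ENNReal.continuous_pow 2).comp_continuousOn (continuous_enorm.comp_continuousOn this)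
  calc ENNReal.ofReal (R / 2) * ENNReal.ofReal (R / 2) * ‖f w‖ₑ ^ 2
      ≤ ENNReal.ofReal (R / 2) * ∫⁻ _ in Ioo (R / 2) R, ENNReal.ofReal (2 * Real.pi) * ‖f w‖ₑ ^ 2 := by
        rw [setLIntegral_const, Real.volume_Ioo, mul_assoc, show R - R / 2 = R / 2 by ring,
          mul_comm _ (ENNReal.ofReal (R / 2))]
        gcongr
        refine le_mul_of_one_le_left (by positivity) ?_
        rw [← ENNReal.ofReal_one]
        exact ENNReal.ofReal_le_ofReal (by linarith [Real.pi_gt_three])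
    _ ≤ ENNReal.ofReal (R / 2) * ∫⁻ ρ in Ioo (R / 2) R, ∫⁻ θ in Ioo (-Real.pi) Real.pi,
          ‖f (circleMap w ρ θ)‖ₑ ^ 2 := by
        gcongr 1
        exact setLIntegral_mono' measurableSet_Ioo fun ρ hρ ↦
          enorm_sq_le_lintegral_circle (lt_trans (by linarith) hρ.1) hρ.2 hf
    _ = ENNReal.ofReal (R / 2) * ∫⁻ p in Ioo (R / 2) R ×ˢ Ioo (-Real.pi) Real.pi,
          ‖f (circleMap w p.1 p.2)‖ₑ ^ 2 := by
        rw [Measure.volume_eq_prod, ← Measure.prod_restrict, lintegral_prod]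
        rw [Measure.prod_restrict]
        exact hcont.aemeasurable (measurableSet_Ioo.prod measurableSet_Ioo)
    _ ≤ ∫⁻ p in Ioo (R / 2) R ×ˢ Ioo (-Real.pi) Real.pi,
          ENNReal.ofReal p.1 • (ball w R).indicator (fun z ↦ ‖f z‖ₑ ^ 2)
            (w + Complex.polarCoord.symm p) := by
        rw [← lintegral_const_mul' _ _ ENNReal.ofReal_ne_top]
        refine setLIntegral_mono' (measurableSet_Ioo.prod measurableSet_Ioo) fun p hp ↦ ?_
        rw [hm, indicator_of_mem (hmem p hp), smul_eq_mul]
        gcongr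
        exact hp.1.1.le
    _ ≤ ∫⁻ p in polarCoord.target,
          ENNReal.ofReal p.1 • (ball w R).indicator (fun z ↦ ‖f z‖ₑ ^ 2)
            (w + Complex.polarCoord.symm p) := lintegral_mono_set hsub
    _ = ∫⁻ z in ball w R, ‖f z‖ₑ ^ 2 := by
        rw [Complex.lintegral_comp_polarCoord_symm
          (fun z ↦ (ball w R).indicator (fun z ↦ ‖f z‖ₑ ^ 2) (w + z)),
          lintegral_add_left_eq_self, lintegral_indicator measurableSet_ball]

/-- The Bergman space `A²`: the (classes of) functions in `L²(𝔻, dA)` that are analytic in `𝔻`. -/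
def A2 : Submodule ℂ (Lp ℂ 2 areaMeasure) where
  carrier := {f | ∃ F : ℂ → ℂ, DifferentiableOn ℂ F (ball 0 1) ∧ f =ᵐ[areaMeasure] F}
  add_mem' := by
    rintro f g ⟨F, hF, hf⟩ ⟨G, hG, hg⟩
    exact ⟨F + G, hF.add hG, (Lp.coeFn_add f g).trans (hf.add hg)⟩
  zero_mem' := ⟨0, differentiableOn_const 0, Lp.coeFn_zero ℂ 2 areaMeasure⟩
  smul_mem' := by
    rintro c f ⟨F, hF, hf⟩
    exact ⟨c • F, hF.const_smul c, (Lp.coeFn_smul c f).trans (hf.const_smul c)⟩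

theorem enorm_sq_le_of_ae_eq {f : Lp ℂ 2 areaMeasure} {F : ℂ → ℂ}
    (hF : DifferentiableOn ℂ F (ball 0 1)) (hf : f =ᵐ[areaMeasure] F) {w : ℂ} {R : ℝ} (hR : 0 < R)
    (hw : ball w R ⊆ ball 0 1) :
    ‖F w‖ₑ ^ 2 ≤ (ENNReal.ofReal (R / 2) * ENNReal.ofReal (R / 2))⁻¹ *
      volume (ball (0 : ℂ) 1) * ‖f‖ₑ ^ 2 := by
  have h1 : ‖f‖ₑ ^ 2 = ∫⁻ z, ‖F z‖ₑ ^ 2 ∂areaMeasure := by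
    have h := eLpNorm_nnreal_pow_eq_lintegral (f := f) (μ := areaMeasure) (p := 2) two_ne_zero
    have h' : ‖f‖ₑ = eLpNorm f 2 areaMeasure := Lp.enorm_def f
    simp only [NNReal.coe_ofNat, ENNReal.rpow_ofNat, ENNReal.coe_ofNat] at h
    rw [h', h]
    exact lintegral_congr_ae (hf.mono fun z hz ↦ by simp only [hz])
  have h2 : ∫⁻ z in ball w R, ‖F z‖ₑ ^ 2 ≤ volume (ball (0 : ℂ) 1) * ‖f‖ₑ ^ 2 := by
    rw [h1, areaMeasure, lintegral_smul_measure, smul_eq_mul, ← mul_assoc,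
      ENNReal.mul_inv_cancel (measure_ball_pos _ _ one_pos).ne' measure_ball_lt_top.ne, one_mul]
    exact lintegral_mono_set hw
  have h3 := (enorm_sq_le_lintegral_ball hR (hF.mono hw)).trans h2
  have h4 : ENNReal.ofReal (R / 2) ≠ 0 := by simpa using hR
  rw [mul_assoc]
  rw [← ENNReal.mul_le_iff_le_inv (mul_ne_zero h4 h4)
    (ENNReal.mul_ne_top ENNReal.ofReal_ne_top ENNReal.ofReal_ne_top)]
  exact h3

theorem isClosed_A2 : IsClosed (A2 : Set (Lp ℂ 2 areaMeasure)) := by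
  refine IsSeqClosed.isClosed fun f g hf hg ↦ ?_
  choose F hF hfF using hf
  have key : ∀ w ∈ ball (0 : ℂ) 1, ∃ R > 0, ball w R ⊆ ball 0 1 ∧
      UniformCauchySeqOn F atTop (ball w R) := by
    intro w hw
    obtain ⟨R, hR, hRw⟩ := Metric.isOpen_iff.1 isOpen_ball w hw
    refine ⟨R / 2, half_pos hR, (ball_subset_ball (by linarith)).trans hRw, ?_⟩
    have hsub : ∀ z ∈ ball w (R / 2), ball z (R / 2) ⊆ ball 0 1 := fun z hz ↦
      (ball_subset_ball' (by linarith [mem_ball.1 hz])).trans hRw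
    set K : ℝ≥0∞ := (ENNReal.ofReal (R / 2 / 2) * ENNReal.ofReal (R / 2 / 2))⁻¹ *
      volume (ball (0 : ℂ) 1) with hK
    have hKtop : K ≠ ∞ := by
      have h4 : ENNReal.ofReal (R / 2 / 2) ≠ 0 := by
        rw [Ne, ENNReal.ofReal_eq_zero, not_le]; positivity
      exact ENNReal.mul_ne_top (ENNReal.inv_ne_top.2 (mul_ne_zero h4 h4)) measure_ball_lt_top.ne
    have hest : ∀ m n, ∀ z ∈ ball w (R / 2), ‖F m z - F n z‖ ^ 2 ≤ K.toReal * ‖f m - f n‖ ^ 2 := by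
      intro m n z hz
      have h := enorm_sq_le_of_ae_eq ((hF m).sub (hF n))
        ((Lp.coeFn_sub (f m) (f n)).trans ((hfF m).sub (hfF n))) (half_pos hR) (hsub z hz)
      have h' := ENNReal.toReal_mono (by finiteness) h
      rw [← hK] at h'
      simpa only [ENNReal.toReal_mul, ENNReal.toReal_pow, toReal_enorm, Pi.sub_apply] using h'
    rw [Metric.uniformCauchySeqOn_iff]
    intro ε hε
    obtain ⟨N, hN⟩ := Metric.cauchySeq_iff.1 hg.cauchySeq (ε / (K.toReal + 1)) (by positivity)
    refine ⟨N, fun m hm n hn z hz ↦ ?_⟩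
    have h1 := hN m hm n hn
    rw [dist_eq_norm] at h1 ⊢
    have h2 := hest m n z hz
    have hK0 : 0 ≤ K.toReal := ENNReal.toReal_nonneg
    have h3 : ‖f m - f n‖ * (K.toReal + 1) < ε := by rwa [lt_div_iff₀ (by positivity)] at h1
    refine lt_of_pow_lt_pow_left₀ 2 hε.le (h2.trans_lt ?_)
    calc K.toReal * ‖f m - f n‖ ^ 2 ≤ (‖f m - f n‖ * (K.toReal + 1)) ^ 2 := by
          nlinarith [sq_nonneg ‖f m - f n‖, mul_nonneg hK0 (sq_nonneg ‖f m - f n‖),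
            mul_nonneg (mul_nonneg hK0 hK0) (sq_nonneg ‖f m - f n‖)]
      _ < ε ^ 2 := pow_lt_pow_left₀ h3 (by positivity) two_ne_zero
  have hlim : ∀ z : ℂ, ∃ l, z ∈ ball (0 : ℂ) 1 → Tendsto (fun n ↦ F n z) atTop (𝓝 l) := by
    intro z
    by_cases hz : z ∈ ball (0 : ℂ) 1
    · obtain ⟨R, hR, -, hc⟩ := key z hz
      obtain ⟨l, hl⟩ := cauchySeq_tendsto_of_complete (hc.cauchySeq (mem_ball_self hR))
      exact ⟨l, fun _ ↦ hl⟩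
    · exact ⟨0, fun h ↦ absurd h hz⟩
  choose G hG using hlim
  refine ⟨G, ?_, ?_⟩
  · refine TendstoLocallyUniformlyOn.differentiableOn (F := F) (φ := atTop) ?_
      (Eventually.of_forall hF) isOpen_ball
    refine tendstoLocallyUniformlyOn_of_forall_exists_nhds fun w hw ↦ ?_
    obtain ⟨R, hR, hs, hc⟩ := key w hw
    exact ⟨ball w R, mem_nhdsWithin_of_mem_nhds (ball_mem_nhds w hR),
      hc.tendstoUniformlyOn_of_tendsto fun z hz ↦ hG z (hs hz)⟩
  · obtain ⟨ns, hns, hae⟩ := (tendstoInMeasure_of_tendsto_Lp hg).exists_seq_tendsto_ae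
    filter_upwards [hae, ae_all_iff.2 hfF, ae_mem_ball] with z h1 h2 h3
    refine tendsto_nhds_unique h1 ?_
    simp only [h2]
    exact (hG z h3).comp hns.tendsto_atTop

instance : CompleteSpace A2 := isClosed_A2.completeSpace_coe

/-- The Bergman Toeplitz operator with symbol `u ∈ L^∞(𝔻)`: `h ↦ P (u h)`, where `P` is the
orthogonal projection of `L²(𝔻, dA)` onto `A²`. -/
def toeplitz (u : Lp ℂ ∞ areaMeasure) : A2 →L[ℂ] A2 :=
  A2.orthogonalProjectionOnto ∘L
    (ContinuousLinearMap.mul ℂ ℂ).holderL areaMeasure ∞ 2 2 u ∘L A2.subtypeL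

/-- The operator `(I - T_u T_ū)^{1/2}` on `A²`, where the root is the positive square root (used for
`‖u‖_∞ ≤ 1`, when `I - T_u T_ū` is a positive operator). -/
def defectRoot (u : Lp ℂ ∞ areaMeasure) : A2 →L[ℂ] A2 :=
  positiveSqrt (1 - toeplitz u * toeplitz (star u))

/-- The sub-Bergman space `𝓐(u) = (I - T_u T_ū)^{1/2} A²` with its range-space structure. The space
`𝓐(b̄)` is `SubBergman (star b)`. -/
abbrev SubBergman (u : Lp ℂ ∞ areaMeasure) : Type :=
  RangeSpace (defectRoot u)

/-- The inclusion of `𝓐(u)` in `A²`. -/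
abbrev SubBergman.incl (u : Lp ℂ ∞ areaMeasure) : SubBergman u →ₗ[ℂ] A2 :=
  RangeSpace.incl (defectRoot u)

/-- `b` is analytic in `𝔻` with `sup |b| ≤ 1`, that is, it is in the closed unit ball of `H^∞(𝔻)`.
The values of `b` outside `𝔻` play no role. -/
structure InUnitBallHInf (b : ℂ → ℂ) : Prop where
  differentiableOn : DifferentiableOn ℂ b (ball 0 1)
  norm_le_one : ∀ z ∈ ball (0 : ℂ) 1, ‖b z‖ ≤ 1

theorem InUnitBallHInf.memLp {b : ℂ → ℂ} (hb : InUnitBallHInf b) : MemLp b ∞ areaMeasure :=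
  memLp_top_of_bound (aestronglyMeasurable_of_continuousOn hb.differentiableOn.continuousOn) 1
    (ae_mem_ball.mono hb.norm_le_one)

/-- `b` as an element of `L^∞(𝔻)`. -/
def InUnitBallHInf.symbol {b : ℂ → ℂ} (hb : InUnitBallHInf b) : Lp ℂ ∞ areaMeasure :=
  hb.memLp.toLp b

theorem memLp_polynomial (p : Polynomial ℂ) :
    MemLp (fun z ↦ p.eval z) 2 areaMeasure := by
  obtain ⟨C, hC⟩ := (isCompact_closedBall (0 : ℂ) 1).exists_bound_of_continuousOn
    p.continuous.continuousOn
  exact MemLp.of_bound p.continuous.aestronglyMeasurable C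
    (ae_mem_ball.mono fun z hz ↦ hC z (ball_subset_closedBall hz))

/-- A polynomial as an element of `A²`. -/
def ofPolynomial (p : Polynomial ℂ) : A2 :=
  ⟨(memLp_polynomial p).toLp _, fun z ↦ p.eval z, p.differentiable.differentiableOn,
    (memLp_polynomial p).coeFn_toLp⟩


end Bergman

end

/-! Write `T` for `T_b`. By Douglas' lemma, an inequality `‖A x‖ ≤ C ‖B x‖` between selfadjoint
operators makes the range space of `A` sit in that of `B` with norm at most `C`. The squared norms
of the two defect roots at `h` are `‖h‖² - ‖T* h‖²` for `b` and `‖h‖² - ‖T h‖²` for `b̄`, so part 3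
amounts to `T T* ≤ T* T` and `2 T* T ≤ I + T T*`.

The first inequality holds because `T` is multiplication by `b` while `T*` is a compression of
multiplication by `b̄`. The second (`two_mul_norm_aeval_apply_sq_le`) comes from the bidisk. `A²`
embeds isometrically in `ℓ²(ℕ × ℕ)`, the adjoint being restriction to the diagonal, and this adjoint
intertwines both coordinate shifts with the Bergman shift. For a polynomial `p` bounded by `1` on
the circle, `T h` is the compression of the average of `p(S₁)` and `p(S₂)`, and since `S₁` commutes
with `S₂*` the cross term is exactly `‖T* h‖²`. General `b` follows by approximation.

Density is proved first for `b̄`, where the defect norm is an `L²` norm with weight `1 - |b|²`.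
Schwarz–Pick bounds `1 - |z|²` by a multiple of this weight, and in the weight `1 - |z|²` the
monomials stay orthogonal. This gives both membership of the monomials and the vanishing of anything
orthogonal to them. The contractive inclusion of `𝓐(b̄)` in `𝓐(b)`, which is onto, transfers
density. -/

noncomputable section

open MeasureTheory Metric Set Filter Topology
open scoped ENNReal

/-! ### Douglas' range inclusion lemma and defect operators -/

section Douglas

variable {H : Type*} [NormedAddCommGroup H] [InnerProductSpace ℂ H] [CompleteSpace H]

/-- A vector `p` for which `h ↦ ⟪p, h⟫` is dominated by `h ↦ ‖B h‖` is in the range of the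
adjoint of `B`. -/
theorem exists_adjoint_apply_eq_of_norm_inner_le (B : H →L[ℂ] H) (p : H) {K : ℝ} (hK : 0 ≤ K)
    (h : ∀ x, ‖inner ℂ p x‖ ≤ K * ‖B x‖) :
    ∃ y, ‖y‖ ≤ K ∧ B.adjoint y = p := by
  -- A merely algebraic section of `B` suffices: the functional `B x ↦ ⟪p, x⟫` is bounded by `K` on
  -- the range, so Hahn–Banach and Riesz produce `y`.
  obtain ⟨s, hs⟩ := (B : H →ₗ[ℂ] H).rangeRestrict.exists_rightInverse_of_surjective
    (LinearMap.range_rangeRestrict _)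
  have hs' : ∀ z, B (s z) = z := fun z ↦
    congrArg Subtype.val (LinearMap.congr_fun hs z)
  let φ : ↥(LinearMap.range (B : H →ₗ[ℂ] H)) →L[ℂ] ℂ :=
    LinearMap.mkContinuous (((innerSL ℂ p : H →L[ℂ] ℂ) : H →ₗ[ℂ] ℂ) ∘ₗ s) K fun z ↦ by
      simpa [hs'] using h (s z)
  obtain ⟨g, hg, hgn⟩ := exists_extension_norm_eq _ φ
  refine ⟨(InnerProductSpace.toDual ℂ H).symm g, ?_, ?_⟩
  · rw [LinearIsometryEquiv.norm_map, hgn]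
    exact LinearMap.mkContinuous_norm_le _ hK _
  · refine ext_inner_right ℂ fun x ↦ ?_
    rw [ContinuousLinearMap.adjoint_inner_left, InnerProductSpace.toDual_symm_apply]
    have h1 : g (B x) = inner ℂ p (s ⟨B x, x, rfl⟩) := hg ⟨B x, x, rfl⟩
    -- The section changes `x` only by an element of `ker B`, on which the hypothesis forces `⟪p,
    -- ·⟫` to vanish.
    rw [h1, ← sub_eq_zero, ← inner_sub_right, ← norm_eq_zero]
    refine le_antisymm ((h _).trans ?_) (norm_nonneg _)
    rw [map_sub, hs', sub_self, norm_zero, mul_zero]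

/-- If `B` is selfadjoint, the preimage can be taken orthogonal to the kernel. -/
theorem exists_apply_eq_of_norm_inner_le {B : H →L[ℂ] H} (hB : IsSelfAdjoint B) (p : H) {K : ℝ}
    (hK : 0 ≤ K) (h : ∀ x, ‖inner ℂ p x‖ ≤ K * ‖B x‖) :
    ∃ y ∈ (LinearMap.ker (B : H →ₗ[ℂ] H))ᗮ, ‖y‖ ≤ K ∧ B y = p := by
  obtain ⟨y, hy, hyp⟩ := exists_adjoint_apply_eq_of_norm_inner_le B p hK h
  rw [hB.adjoint_eq] at hyp
  have hc : CompleteSpace (LinearMap.ker (B : H →ₗ[ℂ] H)) :=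
    (ContinuousLinearMap.isClosed_ker B).completeSpace_coe
  obtain ⟨k, hk, m, hm, rfl⟩ := (LinearMap.ker (B : H →ₗ[ℂ] H)).exists_add_mem_mem_orthogonal y
  have hk0 : B k = 0 := hk
  refine ⟨m, hm, le_trans ?_ hy, by rw [← hyp, map_add, hk0, zero_add]⟩
  -- By Pythagoras, dropping the kernel component does not increase the norm.
  have := norm_add_sq_eq_norm_sq_add_norm_sq_of_inner_eq_zero k m (hm k hk)
  exact abs_le_of_sq_le_sq' (by nlinarith [norm_nonneg k]) (norm_nonneg _) |>.2

namespace RangeSpace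

variable (A : H →L[ℂ] H)

theorem norm_eq_norm_preimage (f : RangeSpace A) : ‖f‖ = ‖preimage A f‖ := rfl

theorem preimage_mem (f : RangeSpace A) : preimage A f ∈ (LinearMap.ker (A : H →ₗ[ℂ] H))ᗮ :=
  ((equiv A).symm f).2

theorem apply_preimage (f : RangeSpace A) : A (preimage A f) = incl A f :=
  congrArg (incl A) ((equiv A).apply_symm_apply f)

theorem preimage_map {x : H} (hx : x ∈ (LinearMap.ker (A : H →ₗ[ℂ] H))ᗮ) :
    preimage A (map A x) = x :=
  congrArg Subtype.val ((equiv A).symm_apply_apply ⟨x, hx⟩)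

/-- Domination of `‖A x‖` by `‖B x‖` gives a bounded inclusion of range spaces. -/
theorem exists_incl_eq {A B : H →L[ℂ] H} (hA : IsSelfAdjoint A) (hB : IsSelfAdjoint B) {C : ℝ}
    (hC : 0 ≤ C) (h : ∀ x, ‖A x‖ ≤ C * ‖B x‖) (f : RangeSpace A) :
    ∃ g : RangeSpace B, incl B g = incl A f ∧ ‖g‖ ≤ C * ‖f‖ := by
  obtain ⟨y, hy, hyn, hyB⟩ := exists_apply_eq_of_norm_inner_le hB (incl A f)
    (K := C * ‖f‖) (by positivity) fun x ↦ by
      rw [← apply_preimage, norm_eq_norm_preimage,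
        show inner ℂ (A (preimage A f)) x = inner ℂ (preimage A f) (A x) from
          hA.isSymmetric _ _]
      calc _ ≤ ‖preimage A f‖ * ‖A x‖ := norm_inner_le_norm _ _
        _ ≤ ‖preimage A f‖ * (C * ‖B x‖) := by gcongr; exact h x
        _ = _ := by ring
  refine ⟨map B y, ?_, ?_⟩
  · rw [incl_map, hyB]
  · rwa [norm_eq_norm_preimage, preimage_map B hy]

end RangeSpace

theorem isSelfAdjoint_positiveSqrt (A : H →L[ℂ] H) : IsSelfAdjoint (positiveSqrt A) :=
  (isPositive_positiveSqrt A).isSelfAdjoint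

theorem inner_one_sub_mul_adjoint_apply (S : H →L[ℂ] H) (x : H) :
    inner ℂ ((1 - S * S.adjoint) x) x = ((‖x‖ ^ 2 - ‖S.adjoint x‖ ^ 2 : ℝ) : ℂ) := by
  rw [sub_apply, inner_sub_left, mul_apply_eq_comp,
    ← ContinuousLinearMap.adjoint_inner_right S, inner_self_eq_norm_sq_to_K]
  simp [inner_self_eq_norm_sq_to_K]

theorem norm_adjoint_apply_le_of_norm_le_one {S : H →L[ℂ] H} (hS : ‖S‖ ≤ 1) (x : H) :
    ‖S.adjoint x‖ ≤ ‖x‖ := by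
  simpa using S.adjoint.le_of_opNorm_le ((LinearIsometryEquiv.norm_map _ _).trans_le hS) x

theorem isPositive_one_sub_mul_adjoint {S : H →L[ℂ] H} (hS : ‖S‖ ≤ 1) :
    (1 - S * S.adjoint).IsPositive := by
  rw [ContinuousLinearMap.isPositive_iff_complex]
  intro x
  rw [inner_one_sub_mul_adjoint_apply]
  refine ⟨by simp [-Complex.ofReal_sub], ?_⟩
  rw [RCLike.re_to_complex, Complex.ofReal_re]
  nlinarith [norm_nonneg (S.adjoint x), norm_adjoint_apply_le_of_norm_le_one hS x]

/-- Since the root `B` is selfadjoint, `‖B x‖² = ⟪B² x, x⟫`. After this the root enters only through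
its norms. -/
theorem norm_positiveSqrt_one_sub_mul_adjoint_sq {S : H →L[ℂ] H} (hS : ‖S‖ ≤ 1) (x : H) :
    ‖positiveSqrt (1 - S * S.adjoint) x‖ ^ 2 = ‖x‖ ^ 2 - ‖S.adjoint x‖ ^ 2 := by
  set B := positiveSqrt (1 - S * S.adjoint) with hB
  have h1 : inner ℂ (B (B x)) x = inner ℂ (B x) (B x) :=
    (isSelfAdjoint_positiveSqrt _).isSymmetric _ _
  have h2 : B (B x) = (1 - S * S.adjoint) x := by
    rw [← positiveSqrt_mul_self (isPositive_one_sub_mul_adjoint hS), mul_apply_eq_comp]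
  rw [h2, inner_one_sub_mul_adjoint_apply, inner_self_eq_norm_sq_to_K] at h1
  exact Complex.ofReal_injective ((Complex.ofReal_pow _ _).trans h1.symm)

end Douglas

/-! ### Coordinate shifts on `ℓ²(ℕ × ℕ)` and the bidisk inequality -/

section Shift

open scoped lp

theorem aeval_apply_of_semiconj {E F : Type*} [NormedAddCommGroup E] [NormedSpace ℂ E]
    [NormedAddCommGroup F] [NormedSpace ℂ F] {A : E →L[ℂ] E} {B : F →L[ℂ] F} {R : E →L[ℂ] F}
    (h : ∀ x, R (A x) = B (R x)) (p : Polynomial ℂ) (x : E) :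
    R (Polynomial.aeval A p x) = Polynomial.aeval B p (R x) := by
  induction p using Polynomial.induction_on' generalizing x with
  | add p q hp hq => simp [hp, hq]
  | monomial n a =>
    have hn : ∀ y, R ((A ^ n) y) = (B ^ n) (R y) := by
      induction n with
      | zero => simp
      | succ n ih => intro y; rw [pow_succ, pow_succ, mul_apply_eq_comp, mul_apply_eq_comp, ih, h]
    simp only [Polynomial.aeval_monomial, ← Algebra.smul_def, smul_apply, map_smul, hn]

variable {α β γ : Type*}

/-- The isometry of `ℓ²(α)` into `ℓ²(β)` that transports a function along the injection `σ` and
extends it by zero. -/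
def lpExtend (σ : α ↪ β) : lp (fun _ : α ↦ ℂ) 2 →ₗᵢ[ℂ] lp (fun _ : β ↦ ℂ) 2 where
  toFun x := ⟨Function.extend σ x 0, by
    refine memℓp_gen ?_
    have h := (lp.memℓp x).summable (by norm_num)
    refine (σ.injective.summable_iff fun b hb ↦ ?_).1 ?_
    · rw [Function.extend_apply' _ _ _ (by simpa using hb)]; simp
    · simpa [Function.comp_def, σ.injective.extend_apply] using h⟩
  map_add' x y := by
    ext b
    change Function.extend σ (⇑(x + y)) 0 b = Function.extend σ x 0 b + Function.extend σ y 0 b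
    by_cases hb : ∃ a, σ a = b
    · obtain ⟨a, rfl⟩ := hb
      rw [σ.injective.extend_apply, σ.injective.extend_apply, σ.injective.extend_apply]
      rfl
    · rw [Function.extend_apply' _ _ _ hb, Function.extend_apply' _ _ _ hb,
        Function.extend_apply' _ _ _ hb]
      exact (add_zero 0).symm
  map_smul' c x := by
    ext b
    change Function.extend σ (⇑(c • x)) 0 b = c * Function.extend σ x 0 b
    by_cases hb : ∃ a, σ a = b
    · obtain ⟨a, rfl⟩ := hb
      simp [σ.injective.extend_apply]
    · simp [Function.extend_apply' _ _ _ hb]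
  norm_map' x := by
    rw [lp.norm_eq_tsum_rpow (by norm_num), lp.norm_eq_tsum_rpow (by norm_num)]
    congr 1
    refine (σ.injective.tsum_eq fun b hb ↦ ?_).symm.trans ?_
    · by_contra h
      refine hb ?_
      change ‖Function.extend σ x 0 b‖ ^ _ = 0
      rw [Function.extend_apply' _ _ _ (by simpa using h)]; simp
    · refine tsum_congr fun a ↦ ?_
      change ‖Function.extend σ x 0 (σ a)‖ ^ _ = _
      rw [σ.injective.extend_apply]

theorem lpExtend_apply (σ : α ↪ β) (x : lp (fun _ : α ↦ ℂ) 2) (a : α) :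
    lpExtend σ x (σ a) = x a := σ.injective.extend_apply _ _ _

theorem lpExtend_apply_of_notMem (σ : α ↪ β) (x : lp (fun _ : α ↦ ℂ) 2) {b : β}
    (hb : b ∉ Set.range σ) : lpExtend σ x b = 0 :=
  Function.extend_apply' _ _ _ (by simpa using hb)

theorem lpExtend_single [DecidableEq α] [DecidableEq β] (σ : α ↪ β) (a : α) (c : ℂ) :
    lpExtend σ (lp.single 2 a c) = lp.single 2 (σ a) c := by
  ext b
  by_cases hb : b ∈ Set.range σ
  · obtain ⟨a', rfl⟩ := hb
    rw [lpExtend_apply, lp.single_apply, lp.single_apply]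
    simp [Pi.single_apply]
  · rw [lpExtend_apply_of_notMem σ _ hb, lp.single_apply, Pi.single_apply, if_neg]
    rintro rfl
    exact hb ⟨a, rfl⟩

theorem adjoint_lpExtend_apply (σ : α ↪ β) (y : lp (fun _ : β ↦ ℂ) 2) (a : α) :
    (lpExtend σ).toContinuousLinearMap.adjoint y a = y (σ a) := by
  classical
  have h := (lpExtend σ).toContinuousLinearMap.adjoint_inner_right (lp.single 2 a (1 : ℂ)) y
  rw [LinearIsometry.coe_toContinuousLinearMap, lpExtend_single, lp.inner_single_left,
    lp.inner_single_left] at h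
  simpa using h

theorem lpExtend_trans (σ : α ↪ β) (τ : β ↪ γ) (x : lp (fun _ : α ↦ ℂ) 2) :
    lpExtend (σ.trans τ) x = lpExtend τ (lpExtend σ x) := by
  ext c
  by_cases hc : c ∈ Set.range τ
  · obtain ⟨b, rfl⟩ := hc
    rw [lpExtend_apply]
    by_cases hb : b ∈ Set.range σ
    · obtain ⟨a, rfl⟩ := hb
      rw [lpExtend_apply, ← lpExtend_apply (σ.trans τ) x a]
      rfl
    · rw [lpExtend_apply_of_notMem σ _ hb, lpExtend_apply_of_notMem]
      rintro ⟨a, ha⟩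
      exact hb ⟨a, τ.injective ha⟩
  · rw [lpExtend_apply_of_notMem τ _ hc, lpExtend_apply_of_notMem]
    rintro ⟨a, rfl⟩
    exact hc ⟨σ a, rfl⟩

/-- The isometry of `ℓ²(α)` induced by an injection of `α` into itself, as an operator. -/
def lpShift (σ : α ↪ α) : lp (fun _ : α ↦ ℂ) 2 →L[ℂ] lp (fun _ : α ↦ ℂ) 2 :=
  (lpExtend σ).toContinuousLinearMap

theorem lpShift_mem_unitary (σ : α ≃ α) : lpShift σ.toEmbedding ∈ unitary _ := by
  rw [Unitary.mem_iff]
  constructor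
  · ext x a
    change (lpExtend σ.toEmbedding).toContinuousLinearMap.adjoint (lpExtend σ.toEmbedding x) a = x a
    rw [adjoint_lpExtend_apply, lpExtend_apply]
  · ext x a
    obtain ⟨b, rfl⟩ := σ.surjective a
    change lpExtend σ.toEmbedding ((lpExtend σ.toEmbedding).toContinuousLinearMap.adjoint x)
      (σ.toEmbedding b) = x (σ.toEmbedding b)
    rw [lpExtend_apply, adjoint_lpExtend_apply]

/-- A unitary is normal with spectrum in the circle, so the continuous functional calculus bounds
`p(u)` by the supremum of `|p|` there. -/
theorem norm_aeval_le_of_mem_unitary {A : Type*} [CStarAlgebra A] {u : A} (hu : u ∈ unitary A)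
    {p : Polynomial ℂ} {C : ℝ} (hC : 0 ≤ C) (hp : ∀ z : ℂ, ‖z‖ = 1 → ‖p.eval z‖ ≤ C) :
    ‖Polynomial.aeval u p‖ ≤ C := by
  have hn : IsStarNormal u := Unitary.coe_isStarNormal ⟨u, hu⟩
  rw [← cfc_polynomial p u]
  refine norm_cfc_le hC fun z hz ↦ hp z ?_
  simpa using spectrum.subset_circle_of_unitary hu hz

/-- Von Neumann's inequality for an isometry that is induced by an injection which extends to a
bijection of a larger set. -/
theorem norm_aeval_lpShift_apply_le {σ : α ↪ α} (ι : α ↪ β) (u : β ≃ β)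
    (h : ∀ a, ι (σ a) = u (ι a)) {p : Polynomial ℂ} (hp : ∀ z : ℂ, ‖z‖ = 1 → ‖p.eval z‖ ≤ 1)
    (x : lp (fun _ : α ↦ ℂ) 2) :
    ‖Polynomial.aeval (lpShift σ) p x‖ ≤ ‖x‖ := by
  -- The isometry is the restriction of a unitary to an invariant subspace, and so are its
  -- polynomials.
  have hs : ∀ x, (lpExtend ι).toContinuousLinearMap (lpShift σ x) =
      lpShift u.toEmbedding ((lpExtend ι).toContinuousLinearMap x) := fun x ↦ by
    change lpExtend ι (lpExtend σ x) = lpExtend u.toEmbedding (lpExtend ι x)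
    rw [← lpExtend_trans, ← lpExtend_trans]
    congr 2
    exact Function.Embedding.ext h
  have h1 := aeval_apply_of_semiconj hs p x
  rw [← (lpExtend ι).norm_map, ← (lpExtend ι).norm_map x]
  change ‖(lpExtend ι).toContinuousLinearMap _‖ ≤ _
  rw [h1]
  simpa using ContinuousLinearMap.le_of_opNorm_le _
    (norm_aeval_le_of_mem_unitary (lpShift_mem_unitary u) zero_le_one hp) (lpExtend ι x)

/-- The shift of the first coordinate on `ℕ × ℕ`. -/
def succFst : ℕ × ℕ ↪ ℕ × ℕ :=
  ⟨Prod.map (· + 1) id, (add_left_injective 1).prodMap Function.injective_id⟩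

/-- The shift of the second coordinate on `ℕ × ℕ`. -/
def succSnd : ℕ × ℕ ↪ ℕ × ℕ :=
  ⟨Prod.map id (· + 1), Function.injective_id.prodMap (add_left_injective 1)⟩

/-- The inclusion of `ℕ × ℕ` in `ℤ × ℤ`. -/
def natProdEmbedding : ℕ × ℕ ↪ ℤ × ℤ :=
  ⟨Prod.map Nat.cast Nat.cast, Nat.cast_injective.prodMap Nat.cast_injective⟩

theorem norm_aeval_lpShift_succFst_apply_le {p : Polynomial ℂ}
    (hp : ∀ z : ℂ, ‖z‖ = 1 → ‖p.eval z‖ ≤ 1) (x : lp (fun _ : ℕ × ℕ ↦ ℂ) 2) :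
    ‖Polynomial.aeval (lpShift succFst) p x‖ ≤ ‖x‖ :=
  norm_aeval_lpShift_apply_le natProdEmbedding (Equiv.prodCongr (Equiv.addRight 1) (Equiv.refl _))
    (fun a ↦ by simp [natProdEmbedding, succFst, Prod.map]) hp x

theorem norm_aeval_lpShift_succSnd_apply_le {p : Polynomial ℂ}
    (hp : ∀ z : ℂ, ‖z‖ = 1 → ‖p.eval z‖ ≤ 1) (x : lp (fun _ : ℕ × ℕ ↦ ℂ) 2) :
    ‖Polynomial.aeval (lpShift succSnd) p x‖ ≤ ‖x‖ :=
  norm_aeval_lpShift_apply_le natProdEmbedding (Equiv.prodCongr (Equiv.refl _) (Equiv.addRight 1))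
    (fun a ↦ by simp [natProdEmbedding, succSnd, Prod.map]) hp x

/-- The two operators act on different coordinates. On the row `j = 0`, outside the range of the
forward shift, both products vanish. -/
theorem commute_lpShift_adjoint_lpShift :
    Commute (lpShift succFst) (star (lpShift succSnd)) := by
  ext x ⟨j, k⟩
  change lpExtend succFst ((lpExtend succSnd).toContinuousLinearMap.adjoint x) (j, k) =
    (lpExtend succSnd).toContinuousLinearMap.adjoint (lpExtend succFst x) (j, k)
  rw [adjoint_lpExtend_apply]
  cases j with
  | zero =>
    rw [lpExtend_apply_of_notMem, lpExtend_apply_of_notMem] <;>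
    · rintro ⟨⟨a, b⟩, h⟩
      simp [succFst, succSnd] at h
  | succ j =>
    have h1 := lpExtend_apply succFst ((lpExtend succSnd).toContinuousLinearMap.adjoint x) (j, k)
    have h2 := lpExtend_apply succFst x (j, k + 1)
    rw [adjoint_lpExtend_apply] at h1
    exact h1.trans h2.symm

theorem commute_aeval_lpShift_star_aeval_lpShift (p q : Polynomial ℂ) :
    Commute (Polynomial.aeval (lpShift succFst) p)
      (star (Polynomial.aeval (lpShift succSnd) q)) := by
  have key : ∀ {A : Type _} [Ring A] [Algebra ℂ A] {x y : A}, Commute x y → ∀ r : Polynomial ℂ,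
      Commute (Polynomial.aeval x r) y := by
    intro A _ _ x y h r
    induction r using Polynomial.induction_on' with
    | add p q hp hq => simpa using hp.add_left hq
    | monomial n a =>
      rw [Polynomial.aeval_monomial]
      exact (Algebra.commute_algebraMap_left a y).mul_left (h.pow_left n)
  -- Taking adjoints moves the star to the other factor, so `key` can be applied to one shift at a
  -- time.
  have h1 := (key commute_lpShift_adjoint_lpShift p).star_star
  rw [star_star] at h1
  have h2 := (key h1.symm q).star_star
  rw [star_star] at h2
  exact h2.symm

/-- If `Z` is modelled by the two coordinate shifts of `ℓ²(ℕ × ℕ)` as the Bergman shift is, then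
`2 ‖p(Z) h‖² ≤ ‖h‖² + ‖p(Z)* h‖²` for all polynomials `p` bounded by `1` on the circle. -/
theorem two_mul_norm_aeval_apply_sq_le {H : Type*} [NormedAddCommGroup H] [InnerProductSpace ℂ H]
    [CompleteSpace H] (Z : H →L[ℂ] H) (J : H →ₗᵢ[ℂ] lp (fun _ : ℕ × ℕ ↦ ℂ) 2)
    (h1 : ∀ h j k, J (Z.adjoint h) (j, k) = J h (j + 1, k))
    (h2 : ∀ h j k, J (Z.adjoint h) (j, k) = J h (j, k + 1))
    {p : Polynomial ℂ} (hp : ∀ z : ℂ, ‖z‖ = 1 → ‖p.eval z‖ ≤ 1) (h : H) :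
    2 * ‖Polynomial.aeval Z p h‖ ^ 2 ≤
      ‖h‖ ^ 2 + ‖(Polynomial.aeval Z p).adjoint h‖ ^ 2 := by
  -- `R` is the abstract restriction to the diagonal: a contraction with `R J = I` that intertwines
  -- either coordinate shift with `Z`.
  set R := J.toContinuousLinearMap.adjoint with hR
  have hRJ : ∀ x, R (J x) = x := fun x ↦
    congrArg (fun f : H →L[ℂ] H ↦ f x) J.adjoint_comp_self
  have hRi : ∀ y g, inner ℂ (R y) g = inner ℂ y (J g) := fun y g ↦
    ContinuousLinearMap.adjoint_inner_left _ _ _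
  have hRn : ∀ y, ‖R y‖ ≤ ‖y‖ := fun y ↦ by
    have : ‖R‖ ≤ 1 := (LinearIsometryEquiv.norm_map _ _).trans_le J.norm_toContinuousLinearMap_le
    simpa using R.le_of_opNorm_le this y
  set V := Polynomial.aeval (lpShift succFst) p with hV
  set W := Polynomial.aeval (lpShift succSnd) p with hW
  set T := Polynomial.aeval Z p with hT
  have hRS : ∀ σ : ℕ × ℕ ↪ ℕ × ℕ, (∀ h a, J (Z.adjoint h) a = J h (σ a)) →
      ∀ x, R (Polynomial.aeval (lpShift σ) p x) = T (R x) := by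
    intro σ hσ x
    refine aeval_apply_of_semiconj (fun y ↦ ext_inner_right ℂ fun g ↦ ?_) p x
    have : J (Z.adjoint g) = (lpShift σ).adjoint (J g) := by
      ext a
      rw [hσ]
      exact (adjoint_lpExtend_apply σ (J g) a).symm
    rw [hRi, ← ContinuousLinearMap.adjoint_inner_right Z, hRi, this,
      ContinuousLinearMap.adjoint_inner_right]
  have hRV : ∀ x, R (V x) = T (R x) := hRS succFst fun h a ↦ h1 h a.1 a.2
  have hRW : ∀ x, R (W x) = T (R x) := hRS succSnd fun h a ↦ h2 h a.1 a.2
  have hadj : ∀ S : lp (fun _ : ℕ × ℕ ↦ ℂ) 2 →L[ℂ] lp (fun _ : ℕ × ℕ ↦ ℂ) 2,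
      (∀ x, R (S x) = T (R x)) → S.adjoint (J h) = J (T.adjoint h) := by
    intro S hS
    refine ext_inner_right ℂ fun y ↦ ?_
    rw [ContinuousLinearMap.adjoint_inner_left]
    change inner ℂ (J.toContinuousLinearMap h) _ = inner ℂ (J.toContinuousLinearMap _) _
    rw [← ContinuousLinearMap.adjoint_inner_right, ← ContinuousLinearMap.adjoint_inner_right,
      ContinuousLinearMap.adjoint_inner_left, hS]
  -- With `x = J h`, double commutation gives `⟪V x, W x⟫ = ⟪W* V x, x⟫ = ⟪V W* x, x⟫ = ⟪W* x, V*
  -- x⟫`, and both entries equal `J (T* h)`.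
  have hin : inner ℂ (V (J h)) (W (J h)) = ((‖T.adjoint h‖ ^ 2 : ℝ) : ℂ) := by
    rw [← ContinuousLinearMap.adjoint_inner_left]
    have hc := congrArg (fun f ↦ f (J h)) (commute_aeval_lpShift_star_aeval_lpShift p p).eq
    change V (W.adjoint (J h)) = W.adjoint (V (J h)) at hc
    rw [← hc, ← ContinuousLinearMap.adjoint_inner_right, hadj V hRV, hadj W hRW,
      LinearIsometry.inner_map_map, inner_self_eq_norm_sq_to_K, Complex.ofReal_pow]
    rfl
  -- Either term alone would only give `‖T h‖ ≤ ‖h‖`; the gain comes from expanding the norm of the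
  -- sum, `4 ‖T h‖² ≤ 2 ‖h‖² + 2 ‖T* h‖²`.
  have hTh : (2 : ℂ) • T h = R (V (J h) + W (J h)) := by
    rw [map_add, hRV, hRW, hRJ, two_smul]
  have h3 : 2 * ‖T h‖ ≤ ‖V (J h) + W (J h)‖ := by
    have := hRn (V (J h) + W (J h))
    rw [← hTh, norm_smul] at this
    simpa using this
  have h4 := norm_add_sq (𝕜 := ℂ) (V (J h)) (W (J h))
  rw [hin, RCLike.re_to_complex, Complex.ofReal_re] at h4
  have h5 := norm_aeval_lpShift_succFst_apply_le hp (J h)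
  have h6 := norm_aeval_lpShift_succSnd_apply_le hp (J h)
  rw [J.norm_map] at h5 h6
  have h7 := pow_le_pow_left₀ (norm_nonneg _) h5 2
  have h8 := pow_le_pow_left₀ (norm_nonneg _) h6 2
  have h9 := pow_le_pow_left₀ (by positivity) h3 2
  nlinarith

end Shift

/-! ### Completeness of the polynomials in the Bergman space -/

namespace Bergman

/-- A dilate of an analytic function on the disk is uniformly approximable by polynomials. -/
theorem exists_polynomial_norm_sub_le {F : ℂ → ℂ} (hF : DifferentiableOn ℂ F (ball 0 1)) {r : ℝ}
    (hr0 : 0 < r) (hr1 : r < 1) {ε : ℝ} (hε : 0 < ε) :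
    ∃ p : Polynomial ℂ, ∀ z ∈ closedBall (0 : ℂ) 1, ‖F (r * z) - p.eval z‖ ≤ ε := by
  -- With `r < s < t < 1`, the Taylor series on the disk of radius `t` converges uniformly on the
  -- disk of radius `s`, which contains `r z` for `|z| ≤ 1`.
  obtain ⟨s, hrs, hs1⟩ := exists_between hr1
  obtain ⟨t, hst, ht1⟩ := exists_between hs1
  have hs0 : 0 < s := hr0.trans hrs
  have ht0 : 0 < t := hs0.trans hst
  lift s to NNReal using hs0.le
  lift t to NNReal using ht0.le
  have hps := (hF.mono (closedBall_subset_ball ht1)).hasFPowerSeriesOnBall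
    (R := t) (by exact_mod_cast ht0)
  have hu := hps.tendstoUniformlyOn' (r' := s) (by exact_mod_cast hst)
  rw [Metric.tendstoUniformlyOn_iff] at hu
  obtain ⟨n, hn⟩ := (hu ε hε).exists
  set q := cauchyPowerSeries F 0 t
  refine ⟨∑ k ∈ Finset.range n, Polynomial.C (q.coeff k * r ^ k) * Polynomial.X ^ k,
    fun z hz ↦ ?_⟩
  have hz' : ‖z‖ ≤ 1 := by simpa using hz
  have := hn (r * z) (by
    simp only [mem_ball_zero_iff, norm_mul, Complex.norm_real, Real.norm_eq_abs,
      abs_of_pos hr0]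
    nlinarith [norm_nonneg z])
  rw [dist_eq_norm, sub_zero] at this
  refine le_trans (le_of_eq ?_) this.le
  congr 2
  simp only [FormalMultilinearSeries.partialSum, FormalMultilinearSeries.apply_eq_pow_smul_coeff,
    Polynomial.eval_finsetSum, Polynomial.eval_mul, Polynomial.eval_C, Polynomial.eval_pow,
    Polynomial.eval_X, smul_eq_mul]
  refine Finset.sum_congr rfl fun k _ ↦ ?_
  ring

theorem enorm_sq_eq_lintegral (f : Lp ℂ 2 areaMeasure) :
    ‖f‖ₑ ^ 2 = ∫⁻ z, ‖f z‖ₑ ^ 2 ∂areaMeasure := by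
  have h := eLpNorm_nnreal_pow_eq_lintegral (f := f) (μ := areaMeasure) (p := 2) two_ne_zero
  simp only [NNReal.coe_ofNat, ENNReal.rpow_ofNat, ENNReal.coe_ofNat] at h
  rw [Lp.enorm_def, h]

/-- Substitute `w = r z`: the Jacobian is `r⁻²`, and `r 𝔻` lies in `𝔻`. -/
theorem lintegral_comp_mul_le {r : ℝ} (hr0 : 0 < r) (hr1 : r ≤ 1) (G : ℂ → ℝ≥0∞) :
    ∫⁻ z, G (r * z) ∂areaMeasure ≤ ENNReal.ofReal (r⁻¹ ^ 2) * ∫⁻ z, G z ∂areaMeasure := by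
  rw [areaMeasure, lintegral_smul_measure, lintegral_smul_measure, smul_eq_mul, smul_eq_mul,
    mul_left_comm]
  gcongr
  rw [← lintegral_indicator measurableSet_ball, ← lintegral_indicator measurableSet_ball]
  have hm : MeasurableEmbedding (fun z : ℂ ↦ r • z) :=
    (Homeomorph.smulOfNeZero r hr0.ne').measurableEmbedding
  calc _ ≤ ∫⁻ z : ℂ, (ball 0 1).indicator G (r • z) := by
        refine lintegral_mono fun z ↦ ?_
        by_cases hz : z ∈ ball (0 : ℂ) 1
        · rw [indicator_of_mem hz, indicator_of_mem, Complex.real_smul]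
          rw [mem_ball_zero_iff] at hz ⊢
          rw [norm_smul, Real.norm_eq_abs, abs_of_pos hr0]
          nlinarith [norm_nonneg z]
        · rw [indicator_of_notMem hz]
          exact zero_le
    _ = ∫⁻ z, (ball 0 1).indicator G z ∂(Measure.map (fun z : ℂ ↦ r • z) volume) :=
        (hm.lintegral_map _).symm
    _ = _ := by
        rw [Measure.map_addHaar_smul _ hr0.ne', lintegral_smul_measure, smul_eq_mul,
          Complex.finrank_real_complex, abs_of_pos (by positivity), inv_pow]

theorem enorm_sq_eq_lintegral_of_ae_eq {h : A2} {F : ℂ → ℂ}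
    (hF : (h : Lp ℂ 2 areaMeasure) =ᵐ[areaMeasure] F) :
    ‖h‖ₑ ^ 2 = ∫⁻ z, ‖F z‖ₑ ^ 2 ∂areaMeasure :=
  (enorm_sq_eq_lintegral (h : Lp ℂ 2 areaMeasure)).trans
    (lintegral_congr_ae (hF.mono fun z hz ↦ by simp only [hz]))

/-- Functions in `A²` given by a bounded analytic function. -/
theorem exists_ae_eq_of_norm_le {F : ℂ → ℂ} (hF : DifferentiableOn ℂ F (ball 0 1)) {C : ℝ}
    (hC : ∀ z ∈ ball (0 : ℂ) 1, ‖F z‖ ≤ C) :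
    ∃ f : A2, (f : Lp ℂ 2 areaMeasure) =ᵐ[areaMeasure] F := by
  have hm : MemLp F 2 areaMeasure := MemLp.of_bound
    (aestronglyMeasurable_of_continuousOn hF.continuousOn) C (ae_mem_ball.mono hC)
  exact ⟨⟨hm.toLp F, F, hF, hm.coeFn_toLp⟩, hm.coeFn_toLp⟩

theorem norm_le_of_ae_norm_le {f : Lp ℂ 2 areaMeasure} {C : ℝ} (hC : 0 ≤ C)
    (h : ∀ᵐ z ∂areaMeasure, ‖f z‖ ≤ C) : ‖f‖ ≤ C := by
  simpa [measureUnivNNReal] using Lp.norm_le_of_ae_bound hC h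

theorem coeFn_ofPolynomial (p : Polynomial ℂ) :
    (ofPolynomial p : Lp ℂ 2 areaMeasure) =ᵐ[areaMeasure] fun z ↦ p.eval z :=
  (memLp_polynomial p).coeFn_toLp

/-- A dilate is a uniform limit of polynomials on the disk, hence also a limit in `L²` of the
probability measure. -/
theorem inner_dilate_eq_zero {h g : A2} (hh : ∀ p, inner ℂ (ofPolynomial p) h = 0)
    {F : ℂ → ℂ} (hF : DifferentiableOn ℂ F (ball 0 1)) {r : ℝ} (hr0 : 0 < r) (hr1 : r < 1)
    (hg : (g : Lp ℂ 2 areaMeasure) =ᵐ[areaMeasure] fun z ↦ F (r * z)) : inner ℂ g h = 0 := by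
  rw [← norm_le_zero_iff]
  refine le_of_forall_pos_le_add fun ε hε ↦ ?_
  obtain ⟨p, hp⟩ := exists_polynomial_norm_sub_le hF hr0 hr1 (ε := ε / (‖h‖ + 1)) (by positivity)
  have h1 : ‖g - ofPolynomial p‖ ≤ ε / (‖h‖ + 1) := by
    refine norm_le_of_ae_norm_le (f := ((g - ofPolynomial p : A2) : Lp ℂ 2 areaMeasure))
      (by positivity) ?_
    filter_upwards [Lp.coeFn_sub (g : Lp ℂ 2 areaMeasure) (ofPolynomial p), hg,
      coeFn_ofPolynomial p, ae_mem_ball] with z h1 h2 h3 h4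
    rw [Submodule.coe_sub, h1, Pi.sub_apply, h2, h3]
    exact hp z (ball_subset_closedBall h4)
  have h2 : inner ℂ g h = inner ℂ (g - ofPolynomial p) h := by rw [inner_sub_left, hh, sub_zero]
  rw [h2, zero_add]
  calc _ ≤ ‖g - ofPolynomial p‖ * ‖h‖ := norm_inner_le_norm _ _
    _ ≤ ε / (‖h‖ + 1) * (‖h‖ + 1) := by gcongr; linarith
    _ = ε := by field_simp

/-- The dilate is orthogonal to `h`, so Pythagoras applies, and its squared norm is at most `r⁻²
‖h‖²`. -/
theorem lintegral_dilate_add_le {h : A2} (hh : ∀ p, inner ℂ (ofPolynomial p) h = 0)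
    {F : ℂ → ℂ} (hF : DifferentiableOn ℂ F (ball 0 1))
    (hhF : (h : Lp ℂ 2 areaMeasure) =ᵐ[areaMeasure] F) {r : ℝ} (hr0 : 0 < r) (hr1 : r < 1) :
    ∫⁻ z, ‖F (r * z) + F z‖ₑ ^ 2 ∂areaMeasure ≤ (ENNReal.ofReal (r⁻¹ ^ 2) + 1) * ‖h‖ₑ ^ 2 := by
  have hmap : ∀ z ∈ closedBall (0 : ℂ) 1, (r : ℂ) * z ∈ closedBall (0 : ℂ) r := fun z hz ↦ by
    rw [mem_closedBall_zero_iff] at hz ⊢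
    rw [norm_mul, Complex.norm_real, Real.norm_eq_abs, abs_of_pos hr0]
    nlinarith
  have hd : DifferentiableOn ℂ (fun z ↦ F (r * z)) (ball 0 1) :=
    hF.comp (by fun_prop) fun z hz ↦
      closedBall_subset_ball hr1 (hmap z (ball_subset_closedBall hz))
  obtain ⟨C, hC⟩ := (isCompact_closedBall (0 : ℂ) r).exists_bound_of_continuousOn
    (hF.continuousOn.mono (closedBall_subset_ball hr1))
  obtain ⟨g, hg⟩ := exists_ae_eq_of_norm_le hd (C := C) fun z hz ↦
    hC _ (hmap z (ball_subset_closedBall hz))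
  have hgh := inner_dilate_eq_zero hh hF hr0 hr1 hg
  have h1 : ‖g + h‖ ^ 2 = ‖g‖ ^ 2 + ‖h‖ ^ 2 := by
    simpa [sq] using norm_add_sq_eq_norm_sq_add_norm_sq_of_inner_eq_zero g h hgh
  have h2 : ‖g + h‖ₑ ^ 2 = ‖g‖ₑ ^ 2 + ‖h‖ₑ ^ 2 := by
    simp only [← ofReal_norm, ← ENNReal.ofReal_pow (norm_nonneg _)]
    rw [h1, ENNReal.ofReal_add (by positivity) (by positivity)]
  have h3 : ‖g + h‖ₑ ^ 2 = ∫⁻ z, ‖F (r * z) + F z‖ₑ ^ 2 ∂areaMeasure := by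
    refine enorm_sq_eq_lintegral_of_ae_eq ?_
    filter_upwards [Lp.coeFn_add (g : Lp ℂ 2 areaMeasure) h, hg, hhF] with z h1 h2 h3
    rw [Submodule.coe_add, h1, Pi.add_apply, h2, h3]
  have h4 : ‖g‖ₑ ^ 2 ≤ ENNReal.ofReal (r⁻¹ ^ 2) * ‖h‖ₑ ^ 2 := by
    rw [enorm_sq_eq_lintegral_of_ae_eq hhF, enorm_sq_eq_lintegral_of_ae_eq hg]
    exact lintegral_comp_mul_le hr0 hr1.le fun z ↦ ‖F z‖ₑ ^ 2
  rw [← h3, h2, add_mul, one_mul]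
  gcongr

/-- As `r → 1`, the functions `F(r z) + F(z)` tend pointwise to `2 F`. Fatou and
`lintegral_dilate_add_le` give `4 ‖h‖² ≤ 2 ‖h‖²`; norm convergence of the dilates is never needed.
-/
theorem eq_zero_of_forall_inner_ofPolynomial {h : A2}
    (hh : ∀ p, inner ℂ (ofPolynomial p) h = 0) : h = 0 := by
  obtain ⟨F, hF, hhF⟩ := h.2
  set r : ℕ → ℝ := fun n ↦ 1 - 1 / ((n : ℝ) + 2) with hr
  have hr0 : ∀ n, 0 < r n := fun n ↦ by
    rw [hr]; simp only [sub_pos]; rw [div_lt_one (by positivity)]; linarith [n.cast_nonneg (α := ℝ)]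
  have hr1 : ∀ n, r n < 1 := fun n ↦ sub_lt_self _ (by positivity)
  have hrt : Tendsto r atTop (𝓝 1) := by
    have := (tendsto_one_div_add_atTop_nhds_zero_nat (𝕜 := ℝ)).comp (tendsto_add_atTop_nat 1)
    have := this.const_sub 1
    rw [sub_zero] at this
    refine this.congr fun n ↦ ?_
    simp only [Function.comp, hr]
    push_cast
    ring
  have hfat := lintegral_liminf_le' (μ := areaMeasure) (u := atTop)
    (f := fun n z ↦ ‖F (r n * z) + F z‖ₑ ^ 2)
    fun n ↦ by
      have : AEStronglyMeasurable (fun z ↦ F (r n * z) + F z) areaMeasure := by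
        refine aestronglyMeasurable_of_continuousOn (ContinuousOn.add ?_ hF.continuousOn)
        refine hF.continuousOn.comp (by fun_prop) fun z hz ↦ ?_
        rw [mem_ball_zero_iff] at hz ⊢
        rw [norm_mul, Complex.norm_real, Real.norm_eq_abs, abs_of_pos (hr0 n)]
        nlinarith [norm_nonneg z, hr0 n, hr1 n]
      exact this.enorm.pow_const 2
  have hR : liminf (fun n ↦ ∫⁻ z, ‖F (r n * z) + F z‖ₑ ^ 2 ∂areaMeasure) atTop ≤
      2 * ‖h‖ₑ ^ 2 := by
    have ht : Tendsto (fun n ↦ (ENNReal.ofReal ((r n)⁻¹ ^ 2) + 1) * ‖h‖ₑ ^ 2) atTop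
        (𝓝 (2 * ‖h‖ₑ ^ 2)) := by
      refine ENNReal.Tendsto.mul_const ?_ (Or.inr (by finiteness))
      have h1 : Tendsto (fun n ↦ (r n)⁻¹ ^ 2) atTop (𝓝 (1⁻¹ ^ 2)) := (hrt.inv₀ one_ne_zero).pow 2
      have := (ENNReal.tendsto_ofReal h1).add_const 1
      simpa [one_add_one_eq_two] using this
    rw [← ht.liminf_eq]
    exact liminf_le_liminf (Eventually.of_forall fun n ↦
      lintegral_dilate_add_le hh hF hhF (hr0 n) (hr1 n))
  have hL : ∫⁻ z, liminf (fun n ↦ ‖F (r n * z) + F z‖ₑ ^ 2) atTop ∂areaMeasure = 4 * ‖h‖ₑ ^ 2 := by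
    rw [enorm_sq_eq_lintegral_of_ae_eq hhF, ← lintegral_const_mul' _ _ (by finiteness)]
    refine lintegral_congr_ae ?_
    filter_upwards [ae_mem_ball] with z hz
    have hc : Tendsto (fun n ↦ F (r n * z)) atTop (𝓝 (F z)) := by
      have h1 : Tendsto (fun n ↦ (r n : ℂ) * z) atTop (𝓝 z) := by
        simpa using ((Complex.continuous_ofReal.tendsto 1).comp hrt).mul_const z
      exact ((hF.continuousOn.continuousAt (isOpen_ball.mem_nhds hz)).tendsto.comp h1)
    have h2 := ((ENNReal.continuous_pow 2).tendsto _).comp ((hc.add_const (F z)).enorm)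
    refine (Tendsto.liminf_eq h2).trans ?_
    rw [← two_mul, enorm_mul, mul_pow]
    congr 1
    rw [← ofReal_norm, Complex.norm_ofNat]
    norm_num
  have h42 : 4 * ‖h‖ₑ ^ 2 ≤ 2 * ‖h‖ₑ ^ 2 := hL.symm.trans_le (hfat.trans hR)
  have h43 := ENNReal.toReal_mono (by finiteness) h42
  simp only [ENNReal.toReal_mul, ENNReal.toReal_pow, toReal_enorm, ENNReal.toReal_ofNat] at h43
  have : ‖h‖ ^ 2 ≤ 0 := by linarith
  exact norm_eq_zero.1 (pow_eq_zero_iff two_ne_zero |>.1 (le_antisymm this (sq_nonneg _)))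

/-! ### The monomial basis and the embedding in `ℓ²(ℕ × ℕ)` -/

theorem integral_Ioo_exp_int_mul (k : ℤ) :
    ∫ θ in Ioo (-Real.pi) Real.pi, Complex.exp (k * θ * Complex.I) =
      if k = 0 then ((2 * Real.pi : ℝ) : ℂ) else 0 := by
  rw [← integral_Ioc_eq_integral_Ioo, ← intervalIntegral.integral_of_le (by linarith [Real.pi_pos])]
  split_ifs with hk
  · simp only [hk, Int.cast_zero, zero_mul, Complex.exp_zero, intervalIntegral.integral_const,
      Complex.real_smul, mul_one]
    congr 1
    ring
  · have hc : (k : ℂ) * Complex.I ≠ 0 := mul_ne_zero (by exact_mod_cast hk) Complex.I_ne_zero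
    have h := integral_exp_mul_complex (a := -Real.pi) (b := Real.pi) hc
    have e : ∀ θ : ℝ, (k : ℂ) * θ * Complex.I = k * Complex.I * θ := fun θ ↦ by ring
    simp only [e]
    rw [h, div_eq_zero_iff, sub_eq_zero]
    left
    rw [Complex.exp_eq_exp_iff_exists_int]
    exact ⟨k, by push_cast; ring⟩

/-- In polar coordinates the angular integral kills `m ≠ n`. For `m = n` it is `2π`, the radial one
is `1 / (2n + 2)`, and the normalization divides by `π`. -/
theorem integral_areaMeasure_pow_mul_conj_pow (m n : ℕ) :
    ∫ z, z ^ n * (starRingEnd ℂ z) ^ m ∂areaMeasure = if m = n then 1 / ((n : ℂ) + 1) else 0 := by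
  have hpi : (Real.pi : ℂ) ≠ 0 := by exact_mod_cast Real.pi_ne_zero
  have h1 : ∀ p ∈ polarCoord.target, p.1 • (ball (0 : ℂ) 1).indicator
      (fun z : ℂ ↦ z ^ n * (starRingEnd ℂ z) ^ m) (Complex.polarCoord.symm p) =
      (((Iio (1 : ℝ)).indicator (fun r ↦ r ^ (n + m + 1)) p.1 : ℝ) : ℂ) *
        Complex.exp (((n : ℤ) - (m : ℤ) : ℤ) * p.2 * Complex.I) := by
    rintro ⟨r, θ⟩ ⟨hr, hθ⟩
    have hr0 : 0 < r := hr
    have hz : Complex.polarCoord.symm (r, θ) = r * Complex.exp (θ * Complex.I) := by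
      simp [Complex.exp_mul_I]
    have hn : ‖Complex.polarCoord.symm (r, θ)‖ = r := by
      rw [Complex.norm_polarCoord_symm, abs_of_pos hr0]
    by_cases h : r < 1
    · rw [indicator_of_mem (by simpa [hn, abs_of_pos hr0] using h),
        indicator_of_mem (by simpa using h), hz,
        map_mul, Complex.conj_ofReal, ← Complex.exp_conj, map_mul, Complex.conj_ofReal,
        Complex.conj_I, mul_pow, mul_pow, ← Complex.exp_nat_mul, ← Complex.exp_nat_mul,
        Complex.real_smul]
      rw [show (((n : ℤ) - (m : ℤ) : ℤ) : ℂ) * θ * Complex.I =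
        n * (θ * Complex.I) + m * (θ * -Complex.I) by push_cast; ring, Complex.exp_add]
      push_cast
      ring
    · rw [indicator_of_notMem (by simpa [hn, abs_of_pos hr0] using h),
        indicator_of_notMem (by simpa using h)]
      simp
  have h2 : ∫ r in Ioi (0 : ℝ), (((Iio (1 : ℝ)).indicator (fun r ↦ r ^ (n + m + 1)) r : ℝ) : ℂ) =
      1 / ((n : ℂ) + m + 2) := by
    rw [integral_complex_ofReal, integral_indicator measurableSet_Iio,
      Measure.restrict_restrict measurableSet_Iio, inter_comm, Ioi_inter_Iio,
      ← integral_Ioc_eq_integral_Ioo, ← intervalIntegral.integral_of_le zero_le_one, integral_pow]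
    push_cast
    norm_num
    ring
  rw [areaMeasure, integral_smul_measure, ← integral_indicator measurableSet_ball,
    ← Complex.integral_comp_polarCoord_symm,
    setIntegral_congr_fun polarCoord.open_target.measurableSet h1, polarCoord_target,
    Measure.volume_eq_prod, setIntegral_prod_mul
      (fun r : ℝ ↦ (((Iio (1 : ℝ)).indicator (fun r ↦ r ^ (n + m + 1)) r : ℝ) : ℂ))
      (fun θ : ℝ ↦ Complex.exp (((n : ℤ) - (m : ℤ) : ℤ) * θ * Complex.I)),
    h2, integral_Ioo_exp_int_mul, Complex.volume_ball]
  by_cases hmn : m = n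
  · subst hmn
    have h3 : ((m : ℂ) + m + 2) ≠ 0 := by exact_mod_cast (by omega : m + m + 2 ≠ 0)
    have h4 : ((m : ℂ) + 1) ≠ 0 := by exact_mod_cast (by omega : m + 1 ≠ 0)
    simp only [sub_self, if_true, ENNReal.toReal_inv, ENNReal.ofReal_one, one_pow, one_mul,
      ENNReal.coe_toReal, NNReal.coe_real_pi, Complex.real_smul]
    push_cast
    rw [show (m : ℂ) + m + 2 = 2 * (m + 1) by ring]
    field_simp
  · rw [if_neg (by omega), if_neg hmn, mul_zero, smul_zero]

theorem inner_smul_left (c : ℂ) (f g : A2) :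
    inner ℂ (c • f) g = starRingEnd ℂ c * inner ℂ f g := _root_.inner_smul_left f g c

theorem inner_smul_right (c : ℂ) (f g : A2) :
    inner ℂ f (c • g) = c * inner ℂ f g := _root_.inner_smul_right f g c

/-- The monomial `z ^ n` as an element of `A²`. -/
def monomial (n : ℕ) : A2 := ofPolynomial (Polynomial.X ^ n)

theorem coeFn_monomial (n : ℕ) :
    (monomial n : Lp ℂ 2 areaMeasure) =ᵐ[areaMeasure] fun z ↦ z ^ n :=
  (coeFn_ofPolynomial _).trans (by simp)

theorem inner_monomial (m n : ℕ) :
    inner ℂ (monomial m) (monomial n) = if m = n then 1 / ((n : ℂ) + 1) else 0 := by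
  rw [← integral_areaMeasure_pow_mul_conj_pow, Submodule.coe_inner, L2.inner_def]
  refine integral_congr_ae ?_
  filter_upwards [coeFn_monomial m, coeFn_monomial n] with z h1 h2
  rw [h1, h2]
  simp

theorem ofPolynomial_eq_sum (p : Polynomial ℂ) :
    ofPolynomial p = ∑ k ∈ p.support, p.coeff k • monomial k := by
  apply Subtype.ext
  apply Lp.ext
  have h1 : ∀ k : ℕ, ((p.coeff k • monomial k : A2) : Lp ℂ 2 areaMeasure) =ᵐ[areaMeasure]
      fun z ↦ p.coeff k * z ^ k := fun k ↦ by
    filter_upwards [Lp.coeFn_smul (p.coeff k) (monomial k : Lp ℂ 2 areaMeasure),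
      coeFn_monomial k] with z h1 h2
    rw [Submodule.coe_smul, h1, Pi.smul_apply, h2, smul_eq_mul]
  rw [Submodule.coe_sum]
  filter_upwards [Lp.coeFn_finsetSum p.support
    (fun k ↦ ((p.coeff k • monomial k : A2) : Lp ℂ 2 areaMeasure)), ae_all_iff.2 h1,
    coeFn_ofPolynomial p] with z h2 h3 h4
  rw [h2, Finset.sum_apply, h4, Polynomial.eval_eq_sum, Polynomial.sum]
  exact Finset.sum_congr rfl fun k _ ↦ (h3 k).symm

theorem eq_zero_of_forall_inner_monomial {h : A2} (hh : ∀ n, inner ℂ (monomial n) h = 0) :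
    h = 0 := by
  refine eq_zero_of_forall_inner_ofPolynomial fun p ↦ ?_
  rw [ofPolynomial_eq_sum, sum_inner]
  exact Finset.sum_eq_zero fun k _ ↦ by rw [inner_smul_left, hh, mul_zero]

theorem orthonormal_monomial :
    Orthonormal ℂ fun n : ℕ ↦ ((√((n : ℝ) + 1) : ℝ) : ℂ) • monomial n := by
  rw [orthonormal_iff_ite]
  intro m n
  rw [inner_smul_left, inner_smul_right, inner_monomial]
  split_ifs with h
  · subst h
    rw [Complex.conj_ofReal, ← mul_assoc, ← Complex.ofReal_mul, Real.mul_self_sqrt (by positivity)]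
    have h4 : ((m : ℂ) + 1) ≠ 0 := by exact_mod_cast (by omega : m + 1 ≠ 0)
    push_cast
    field_simp
  · simp

/-- The Hilbert basis of `A²` consisting of the normalized monomials. -/
def monomialBasis : HilbertBasis ℕ ℂ A2 :=
  HilbertBasis.mkOfOrthogonalEqBot orthonormal_monomial <| by
    rw [Submodule.eq_bot_iff]
    intro h hh
    refine eq_zero_of_forall_inner_monomial fun n ↦ ?_
    have := hh _ (Submodule.subset_span ⟨n, rfl⟩)
    simp only [inner_smul_left, mul_eq_zero] at this
    refine this.resolve_left ?_
    rw [Complex.conj_ofReal, Complex.ofReal_eq_zero]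
    positivity

theorem hasSum_norm_inner_monomial_sq (h : A2) :
    HasSum (fun n : ℕ ↦ ((n : ℝ) + 1) * ‖inner ℂ (monomial n) h‖ ^ 2) (‖h‖ ^ 2) := by
  have h1 := Complex.hasSum_re (monomialBasis.hasSum_inner_mul_inner h h)
  rw [inner_self_eq_norm_sq_to_K] at h1
  convert h1 using 1
  · funext n
    rw [← inner_conj_symm h, ← Complex.normSq_eq_conj_mul_self, Complex.ofReal_re,
      Complex.normSq_eq_norm_sq]
    simp only [monomialBasis, HilbertBasis.coe_mkOfOrthogonalEqBot]
    rw [inner_smul_left, norm_mul, Complex.conj_ofReal, Complex.norm_real, Real.norm_eq_abs,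
      mul_pow, sq_abs,
      Real.sq_sqrt (by positivity)]
  · norm_cast

/-- There are `n + 1` pairs with `j + k = n`, which is exactly the weight of `z ^ n` in Parseval's
identity. This is why the diagonal embedding is isometric. -/
theorem hasSum_norm_inner_monomial_add_sq (h : A2) :
    HasSum (fun a : ℕ × ℕ ↦ ‖inner ℂ (monomial (a.1 + a.2)) h‖ ^ 2) (‖h‖ ^ 2) := by
  rw [← Finset.HasAntidiagonal.sigmaAntidiagonalEquivProd.hasSum_iff]
  have e : ∀ (n : ℕ) (a : Finset.HasAntidiagonal.antidiagonal n), a.1.1 + a.1.2 = n := fun n a ↦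
    Finset.HasAntidiagonal.mem_antidiagonal.1 a.2
  have h1 : ∀ n : ℕ, ∑ a : Finset.HasAntidiagonal.antidiagonal n,
      ‖inner ℂ (monomial (a.1.1 + a.1.2)) h‖ ^ 2 =
      ((n : ℝ) + 1) * ‖inner ℂ (monomial n) h‖ ^ 2 := fun n ↦ by
    simp [e]
  refine HasSum.sigma_of_hasSum (hasSum_norm_inner_monomial_sq h)
    (fun n ↦ by rw [← h1]; exact hasSum_fintype _) ?_
  refine (summable_sigma_of_nonneg fun _ ↦ sq_nonneg _).2 ⟨fun n ↦ (hasSum_fintype _).summable, ?_⟩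
  refine (hasSum_norm_inner_monomial_sq h).summable.congr fun n ↦ ?_
  rw [← h1, tsum_fintype]
  rfl

/-- The isometry of `A²` into `ℓ²(ℕ × ℕ)` whose adjoint is the restriction to the diagonal of
functions in the Hardy space of the bidisk. -/
def diagonalIsometry : A2 →ₗᵢ[ℂ] lp (fun _ : ℕ × ℕ ↦ ℂ) 2 where
  toFun h := ⟨fun a ↦ inner ℂ (monomial (a.1 + a.2)) h, memℓp_gen (by
    simpa using (hasSum_norm_inner_monomial_add_sq h).summable)⟩
  map_add' x y := by ext a; exact inner_add_right _ _ _
  map_smul' c x := by ext a; exact inner_smul_right _ _ _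
  norm_map' h := by
    refine (sq_eq_sq₀ (norm_nonneg _) (norm_nonneg _)).1 ?_
    rw [← (hasSum_norm_inner_monomial_add_sq h).tsum_eq]
    simpa using lp.norm_rpow_eq_tsum (p := 2) (by norm_num) (E := fun _ : ℕ × ℕ ↦ ℂ) _

theorem diagonalIsometry_apply (h : A2) (a : ℕ × ℕ) :
    diagonalIsometry h a = inner ℂ (monomial (a.1 + a.2)) h := rfl

/-! ### Toeplitz operators and the two operator inequalities -/

/-- Multiplication by a bounded function on `L²(𝔻, dA)`. -/
def mulLp (u : Lp ℂ ∞ areaMeasure) : Lp ℂ 2 areaMeasure →L[ℂ] Lp ℂ 2 areaMeasure :=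
  (ContinuousLinearMap.mul ℂ ℂ).holderL areaMeasure ∞ 2 2 u

theorem coeFn_mulLp (u : Lp ℂ ∞ areaMeasure) (f : Lp ℂ 2 areaMeasure) :
    mulLp u f =ᵐ[areaMeasure] fun z ↦ u z * f z :=
  (ContinuousLinearMap.mul ℂ ℂ).coeFn_holder u f

theorem mulLp_sub (u v : Lp ℂ ∞ areaMeasure) (f : Lp ℂ 2 areaMeasure) :
    mulLp (u - v) f = mulLp u f - mulLp v f := by
  simp only [mulLp, map_sub, sub_apply]

theorem toeplitz_apply (u : Lp ℂ ∞ areaMeasure) (h : A2) :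
    toeplitz u h = A2.orthogonalProjectionOnto (mulLp u h) := rfl

theorem toeplitz_sub (u v : Lp ℂ ∞ areaMeasure) : toeplitz (u - v) = toeplitz u - toeplitz v :=
  ContinuousLinearMap.ext fun h ↦ by
    rw [sub_apply, toeplitz_apply, toeplitz_apply, toeplitz_apply, mulLp_sub, map_sub]

theorem norm_mulLp_star (u : Lp ℂ ∞ areaMeasure) (f : Lp ℂ 2 areaMeasure) :
    ‖mulLp (star u) f‖ = ‖mulLp u f‖ := by
  have key : ∀ᵐ z ∂areaMeasure, ‖mulLp (star u) f z‖ = ‖mulLp u f z‖ := by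
    filter_upwards [coeFn_mulLp (star u) f, coeFn_mulLp u f, Lp.coeFn_star u] with z h1 h2 h3
    rw [h1, h2, h3, norm_mul, norm_mul, Pi.star_apply, norm_star]
  exact le_antisymm (Lp.norm_le_norm_of_ae_le (key.mono fun _ h ↦ h.le))
    (Lp.norm_le_norm_of_ae_le (key.mono fun _ h ↦ h.ge))

theorem norm_toeplitz_apply_le (u : Lp ℂ ∞ areaMeasure) (h : A2) :
    ‖toeplitz u h‖ ≤ ‖mulLp u h‖ :=
  A2.norm_orthogonalProjectionOnto_apply_le _

theorem inner_toeplitz_left (u : Lp ℂ ∞ areaMeasure) (f g : A2) :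
    inner ℂ (toeplitz u f) g = inner ℂ (mulLp u f) (g : Lp ℂ 2 areaMeasure) := by
  rw [toeplitz_apply, Submodule.coe_inner]
  exact Submodule.inner_orthogonalProjectionOnto_eq_of_mem_right g _

theorem inner_mulLp_star_left (u : Lp ℂ ∞ areaMeasure) (f g : Lp ℂ 2 areaMeasure) :
    inner ℂ (mulLp (star u) f) g = inner ℂ f (mulLp u g) := by
  rw [L2.inner_def, L2.inner_def]
  refine integral_congr_ae ?_
  filter_upwards [coeFn_mulLp (star u) f, coeFn_mulLp u g, Lp.coeFn_star u] with z h1 h2 h3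
  rw [h1, h2, h3]
  simp
  ring

theorem toeplitz_star (u : Lp ℂ ∞ areaMeasure) : toeplitz (star u) = (toeplitz u).adjoint := by
  refine ContinuousLinearMap.ext fun f ↦ ext_inner_right ℂ fun g ↦ ?_
  rw [ContinuousLinearMap.adjoint_inner_left, inner_toeplitz_left, inner_mulLp_star_left,
    ← inner_conj_symm f, inner_toeplitz_left, inner_conj_symm]

theorem InUnitBallHInf.coeFn_symbol {b : ℂ → ℂ} (hb : InUnitBallHInf b) :
    hb.symbol =ᵐ[areaMeasure] b := hb.memLp.coeFn_toLp

theorem InUnitBallHInf.coeFn_mulLp_symbol {b : ℂ → ℂ} (hb : InUnitBallHInf b)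
    (f : Lp ℂ 2 areaMeasure) : mulLp hb.symbol f =ᵐ[areaMeasure] fun z ↦ b z * f z := by
  filter_upwards [coeFn_mulLp hb.symbol f, hb.coeFn_symbol] with z h1 h2
  rw [h1, h2]

theorem InUnitBallHInf.mulLp_mem {b : ℂ → ℂ} (hb : InUnitBallHInf b) (h : A2) :
    mulLp hb.symbol h ∈ A2 := by
  obtain ⟨F, hF, hhF⟩ := h.2
  refine ⟨fun z ↦ b z * F z, hb.differentiableOn.mul hF, ?_⟩
  filter_upwards [hb.coeFn_mulLp_symbol h, hhF] with z h1 h2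
  rw [h1, h2]

theorem InUnitBallHInf.coe_toeplitz {b : ℂ → ℂ} (hb : InUnitBallHInf b) (h : A2) :
    (toeplitz hb.symbol h : Lp ℂ 2 areaMeasure) = mulLp hb.symbol h := by
  rw [toeplitz_apply]
  exact congrArg Subtype.val
    (A2.orthogonalProjectionOnto_mem_subspace_eq_self ⟨_, hb.mulLp_mem h⟩)

theorem InUnitBallHInf.norm_mulLp_le {b : ℂ → ℂ} (hb : InUnitBallHInf b)
    (f : Lp ℂ 2 areaMeasure) : ‖mulLp hb.symbol f‖ ≤ ‖f‖ := by
  refine Lp.norm_le_norm_of_ae_le ?_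
  filter_upwards [hb.coeFn_mulLp_symbol f, ae_mem_ball] with z h1 h2
  rw [h1, norm_mul]
  exact mul_le_of_le_one_left (norm_nonneg _) (hb.norm_le_one z h2)

theorem InUnitBallHInf.norm_toeplitz_le {b : ℂ → ℂ} (hb : InUnitBallHInf b) :
    ‖toeplitz hb.symbol‖ ≤ 1 :=
  ContinuousLinearMap.opNorm_le_bound _ zero_le_one fun h ↦ by
    rw [one_mul]
    exact (norm_toeplitz_apply_le _ h).trans (hb.norm_mulLp_le _)

/-- Hyponormality: `‖P(b̄ h)‖ ≤ ‖b̄ h‖ = ‖b h‖`, and `b h` is already analytic. -/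
theorem InUnitBallHInf.norm_adjoint_toeplitz_apply_le {b : ℂ → ℂ} (hb : InUnitBallHInf b)
    (h : A2) : ‖(toeplitz hb.symbol).adjoint h‖ ≤ ‖toeplitz hb.symbol h‖ := by
  rw [← toeplitz_star]
  refine (norm_toeplitz_apply_le _ h).trans ?_
  rw [norm_mulLp_star, ← hb.coe_toeplitz]
  exact le_rfl

theorem inUnitBallHInf_id : InUnitBallHInf fun z ↦ z :=
  ⟨differentiableOn_id, fun z hz ↦ by simpa using (mem_ball_zero_iff.1 hz).le⟩

/-- The Bergman shift, multiplication by `z` on `A²`. -/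
def shift : A2 →L[ℂ] A2 := toeplitz inUnitBallHInf_id.symbol

theorem coeFn_shift (h : A2) :
    (shift h : Lp ℂ 2 areaMeasure) =ᵐ[areaMeasure] fun z ↦ z * (h : Lp ℂ 2 areaMeasure) z := by
  rw [shift, inUnitBallHInf_id.coe_toeplitz]
  exact inUnitBallHInf_id.coeFn_mulLp_symbol _

theorem shift_monomial (n : ℕ) : shift (monomial n) = monomial (n + 1) := by
  apply Subtype.ext
  apply Lp.ext
  filter_upwards [coeFn_shift (monomial n), coeFn_monomial n, coeFn_monomial (n + 1)]
    with z h1 h2 h3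
  rw [h1, h2, h3, pow_succ']

theorem coeFn_aeval_shift (p : Polynomial ℂ) (h : A2) :
    (Polynomial.aeval shift p h : Lp ℂ 2 areaMeasure) =ᵐ[areaMeasure]
      fun z ↦ p.eval z * (h : Lp ℂ 2 areaMeasure) z := by
  induction p using Polynomial.induction_on' with
  | add p q hp hq =>
    rw [map_add, add_apply, Submodule.coe_add]
    filter_upwards [Lp.coeFn_add (Polynomial.aeval shift p h : Lp ℂ 2 areaMeasure)
      (Polynomial.aeval shift q h), hp, hq] with z h1 h2 h3
    rw [h1, Pi.add_apply, h2, h3, Polynomial.eval_add, add_mul]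
  | monomial n a =>
    have hn : ((shift ^ n) h : Lp ℂ 2 areaMeasure) =ᵐ[areaMeasure]
        fun z ↦ z ^ n * (h : Lp ℂ 2 areaMeasure) z := by
      induction n with
      | zero => simp
      | succ n ih =>
        rw [pow_succ', mul_apply_eq_comp]
        filter_upwards [coeFn_shift ((shift ^ n) h), ih] with z h1 h2
        rw [h1, h2, pow_succ', mul_assoc]
    rw [Polynomial.aeval_monomial, ← Algebra.smul_def, smul_apply, Submodule.coe_smul]
    filter_upwards [Lp.coeFn_smul a ((shift ^ n) h : Lp ℂ 2 areaMeasure), hn] with z h1 h2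
    rw [h1, Pi.smul_apply, h2, Polynomial.eval_monomial, smul_eq_mul, mul_assoc]

theorem toeplitz_eval_eq_aeval {p : Polynomial ℂ} (hp : InUnitBallHInf fun z ↦ p.eval z) :
    toeplitz hp.symbol = Polynomial.aeval shift p := by
  refine ContinuousLinearMap.ext fun h ↦ Subtype.ext (Lp.ext ?_)
  rw [hp.coe_toeplitz]
  exact (hp.coeFn_mulLp_symbol _).trans (coeFn_aeval_shift p h).symm

theorem diagonalIsometry_adjoint_shift (h : A2) (a : ℕ × ℕ) :
    diagonalIsometry (shift.adjoint h) a = inner ℂ (monomial (a.1 + a.2 + 1)) h := by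
  rw [diagonalIsometry_apply, ContinuousLinearMap.adjoint_inner_right, shift_monomial]

/-- The entries of `diagonalIsometry h` depend only on `j + k`, so the backward shift in either
coordinate models `shift.adjoint`. -/
theorem two_mul_norm_aeval_shift_sq_le {p : Polynomial ℂ}
    (hp : ∀ z : ℂ, ‖z‖ = 1 → ‖p.eval z‖ ≤ 1) (h : A2) :
    2 * ‖Polynomial.aeval shift p h‖ ^ 2 ≤
      ‖h‖ ^ 2 + ‖(Polynomial.aeval shift p).adjoint h‖ ^ 2 := by
  refine two_mul_norm_aeval_apply_sq_le shift diagonalIsometry (fun h j k ↦ ?_)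
    (fun h j k ↦ ?_) hp h
  · rw [diagonalIsometry_adjoint_shift, diagonalIsometry_apply, add_right_comm]
  · rw [diagonalIsometry_adjoint_shift, diagonalIsometry_apply, add_assoc]

/-- Functions in the unit ball of `H^∞` are pointwise limits of polynomials in the unit ball. -/
theorem InUnitBallHInf.exists_polynomial_tendsto {b : ℂ → ℂ} (hb : InUnitBallHInf b) :
    ∃ p : ℕ → Polynomial ℂ, (∀ n, ∀ z ∈ closedBall (0 : ℂ) 1, ‖(p n).eval z‖ ≤ 1) ∧
      ∀ z ∈ ball (0 : ℂ) 1, Tendsto (fun n ↦ (p n).eval z) atTop (𝓝 (b z)) := by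
  set ε : ℕ → ℝ := fun n ↦ 1 / ((n : ℝ) + 2) with hε
  have hε0 : ∀ n, 0 < ε n := fun n ↦ by positivity
  have hε1 : ∀ n, ε n < 1 := fun n ↦ by
    rw [hε]; simp only; rw [div_lt_one (by positivity)]; linarith [n.cast_nonneg (α := ℝ)]
  have hεt : Tendsto ε atTop (𝓝 0) := by
    refine ((tendsto_one_div_add_atTop_nhds_zero_nat (𝕜 := ℝ)).comp
      (tendsto_add_atTop_nat 1)).congr fun n ↦ ?_
    simp only [Function.comp, hε]
    push_cast
    ring
  -- An `ε`-approximation of the dilate by `1 - ε` is bounded by `1 + ε`; dividing by `1 + ε`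
  -- returns it to the unit ball.
  choose q hq using fun n ↦ exists_polynomial_norm_sub_le hb.differentiableOn (r := 1 - ε n)
    (by linarith [hε1 n]) (by linarith [hε0 n]) (hε0 n)
  have hmem : ∀ n, ∀ z ∈ closedBall (0 : ℂ) 1, ((1 - ε n : ℝ) : ℂ) * z ∈ ball (0 : ℂ) 1 := by
    intro n z hz
    rw [mem_closedBall_zero_iff] at hz
    rw [mem_ball_zero_iff, norm_mul, Complex.norm_real, Real.norm_eq_abs,
      abs_of_pos (by linarith [hε1 n])]
    nlinarith [hε0 n, hε1 n, norm_nonneg z]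
  refine ⟨fun n ↦ Polynomial.C (((1 + ε n)⁻¹ : ℝ) : ℂ) * q n, fun n z hz ↦ ?_, fun z hz ↦ ?_⟩
  · have h1 := hq n z hz
    have h2 := hb.norm_le_one _ (hmem n z hz)
    have h3 : ‖(q n).eval z‖ ≤ 1 + ε n := by
      have := norm_sub_norm_le ((q n).eval z) (b ((1 - ε n : ℝ) * z))
      rw [norm_sub_rev] at this
      linarith
    rw [Polynomial.eval_mul, Polynomial.eval_C, norm_mul, Complex.norm_real, norm_inv,
      Real.norm_eq_abs, abs_of_pos (by linarith [hε0 n])]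
    rw [inv_mul_le_iff₀ (by linarith [hε0 n])]
    linarith
  · have h1 : Tendsto (fun n ↦ b ((1 - ε n : ℝ) * z)) atTop (𝓝 (b z)) := by
      have : Tendsto (fun n ↦ ((1 - ε n : ℝ) : ℂ) * z) atTop (𝓝 z) := by
        have h := (Complex.continuous_ofReal.tendsto _).comp (hεt.const_sub 1)
        simpa using h.mul_const z
      exact ((hb.differentiableOn.continuousOn.continuousAt
        (isOpen_ball.mem_nhds hz)).tendsto.comp this)
    have h2 : Tendsto (fun n ↦ b ((1 - ε n : ℝ) * z) - (q n).eval z) atTop (𝓝 0) :=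
      squeeze_zero_norm (fun n ↦ hq n z (ball_subset_closedBall hz)) hεt
    have h3 : Tendsto (fun n ↦ (((1 + ε n)⁻¹ : ℝ) : ℂ)) atTop (𝓝 1) := by
      have h := (Complex.continuous_ofReal.tendsto _).comp
        ((hεt.const_add 1).inv₀ (by norm_num))
      simpa [Function.comp_def] using h
    have h4 := h3.mul (h1.sub h2)
    simpa using h4

/-- Bounded pointwise convergence of symbols gives strong convergence of the multiplications, by
dominated convergence with majorant `4 |f|²`. -/
theorem InUnitBallHInf.tendsto_norm_mulLp_sub {b : ℂ → ℂ} (hb : InUnitBallHInf b)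
    {c : ℕ → ℂ → ℂ} (hc : ∀ n, InUnitBallHInf (c n))
    (hcb : ∀ z ∈ ball (0 : ℂ) 1, Tendsto (fun n ↦ c n z) atTop (𝓝 (b z)))
    (f : Lp ℂ 2 areaMeasure) :
    Tendsto (fun n ↦ ‖mulLp ((hc n).symbol - hb.symbol) f‖) atTop (𝓝 0) := by
  have hae : ∀ n, mulLp ((hc n).symbol - hb.symbol) f =ᵐ[areaMeasure]
      fun z ↦ (c n z - b z) * f z := fun n ↦ by
    rw [mulLp_sub]
    filter_upwards [Lp.coeFn_sub (mulLp (hc n).symbol f) (mulLp hb.symbol f),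
      (hc n).coeFn_mulLp_symbol f, hb.coeFn_mulLp_symbol f] with z h1 h2 h3
    rw [h1, Pi.sub_apply, h2, h3, sub_mul]
  have hsq : ∀ n, ‖mulLp ((hc n).symbol - hb.symbol) f‖ₑ ^ 2 =
      ∫⁻ z, ‖(c n z - b z) * f z‖ₑ ^ 2 ∂areaMeasure := fun n ↦ by
    rw [enorm_sq_eq_lintegral]
    exact lintegral_congr_ae ((hae n).mono fun z hz ↦ by simp only [hz])
  have hlim : Tendsto (fun n ↦ ∫⁻ z, ‖(c n z - b z) * f z‖ₑ ^ 2 ∂areaMeasure) atTop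
      (𝓝 (∫⁻ _, 0 ∂areaMeasure)) := by
    refine tendsto_lintegral_of_dominated_convergence' (fun z ↦ 4 * ‖f z‖ₑ ^ 2) (fun n ↦ ?_)
      (fun n ↦ ?_) ?_ ?_
    · exact (AEStronglyMeasurable.congr (Lp.aestronglyMeasurable _) (hae n)).enorm.pow_const 2
    · filter_upwards [ae_mem_ball] with z hz
      have h1 : ‖c n z - b z‖ ≤ 2 :=
        (norm_sub_le _ _).trans (by linarith [(hc n).norm_le_one z hz, hb.norm_le_one z hz])
      have h2 : ‖c n z - b z‖ₑ ≤ 2 := by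
        rw [← ofReal_norm]
        exact (ENNReal.ofReal_le_ofReal h1).trans (by norm_num)
      rw [enorm_mul, mul_pow]
      gcongr
      calc _ ≤ (2 : ℝ≥0∞) ^ 2 := by gcongr
        _ = 4 := by norm_num
    · rw [lintegral_const_mul' _ _ (by finiteness), ← enorm_sq_eq_lintegral]
      finiteness
    · filter_upwards [ae_mem_ball] with z hz
      have h1 : Tendsto (fun n ↦ (c n z - b z) * f z) atTop (𝓝 0) := by
        simpa using ((hcb z hz).sub_const (b z)).mul_const (f z)
      have h2 := ((ENNReal.continuous_pow 2).tendsto _).comp h1.enorm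
      simpa [Function.comp_def] using h2
  simp only [← hsq, lintegral_zero] at hlim
  have h1 := (ENNReal.tendsto_toReal ENNReal.zero_ne_top).comp hlim
  have h2 := h1.sqrt
  simpa [Function.comp_def, Real.sqrt_sq] using h2

/-- `2 T_b* T_b ≤ I + T_b T_b*` on the Bergman space. -/
theorem InUnitBallHInf.two_mul_norm_toeplitz_sq_le {b : ℂ → ℂ} (hb : InUnitBallHInf b) (h : A2) :
    2 * ‖toeplitz hb.symbol h‖ ^ 2 ≤
      ‖h‖ ^ 2 + ‖(toeplitz hb.symbol).adjoint h‖ ^ 2 := by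
  obtain ⟨p, hp, hpb⟩ := hb.exists_polynomial_tendsto
  have hc : ∀ n, InUnitBallHInf fun z ↦ (p n).eval z := fun n ↦
    ⟨(p n).differentiable.differentiableOn, fun z hz ↦ hp n z (ball_subset_closedBall hz)⟩
  have ht := hb.tendsto_norm_mulLp_sub hc hpb h
  have h1 : Tendsto (fun n ↦ toeplitz (hc n).symbol h) atTop (𝓝 (toeplitz hb.symbol h)) :=
    tendsto_iff_norm_sub_tendsto_zero.2
      (squeeze_zero (fun _ ↦ norm_nonneg _) (fun n ↦ by
        rw [← sub_apply, ← toeplitz_sub]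
        exact norm_toeplitz_apply_le _ _) ht)
  have h2 : Tendsto (fun n ↦ (toeplitz (hc n).symbol).adjoint h) atTop
      (𝓝 ((toeplitz hb.symbol).adjoint h)) := by
    refine tendsto_iff_norm_sub_tendsto_zero.2
      (squeeze_zero (fun _ ↦ norm_nonneg _) (fun n ↦ ?_) ht)
    -- Conjugating a symbol preserves the norm of the product, so the adjoints converge strongly
    -- too.
    rw [← sub_apply, ← LinearIsometryEquiv.map_sub, ← toeplitz_sub, ← toeplitz_star,
      ← norm_mulLp_star]
    exact norm_toeplitz_apply_le _ _
  refine le_of_tendsto_of_tendsto' ((h1.norm.pow 2).const_mul 2)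
    ((h2.norm.pow 2).const_add (‖h‖ ^ 2)) fun n ↦ ?_
  rw [toeplitz_eval_eq_aeval]
  exact two_mul_norm_aeval_shift_sq_le (fun z hz ↦ hp n z (by simp [hz])) h

end Bergman

/-! ### Completeness and approximation in range spaces -/

namespace RangeSpace

variable {H : Type*} [NormedAddCommGroup H] [InnerProductSpace ℂ H] [CompleteSpace H]
  (A : H →L[ℂ] H)

/-- The range norm makes `equiv` an isometry from the closed subspace `(ker A)ᗮ`. Completeness lets
density be tested by orthogonality. -/
instance : CompleteSpace (RangeSpace A) := by
  have hi : Isometry (equiv A).symm :=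
    AddMonoidHomClass.isometry_of_norm (equiv A).symm fun _ ↦ rfl
  exact (hi.isUniformInducing.completeSpace_congr (equiv A).symm.surjective).2 inferInstance

variable {A}

/-- An element of the range space of a selfadjoint operator `A` is a limit of the elements
`A (A (x k))`; the inner products with it are the limits of those in the ambient space. -/
theorem exists_seq_tendsto_preimage (hA : IsSelfAdjoint A) (f : RangeSpace A) :
    ∃ x : ℕ → H, Tendsto (fun k ↦ A (x k)) atTop (𝓝 (preimage A f)) ∧
      ∀ g : RangeSpace A, Tendsto (fun k ↦ inner ℂ (incl A g) (x k)) atTop (𝓝 (inner ℂ g f)) := by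
  have h := preimage_mem A f
  -- `(ker A)ᗮ` is the closure of the range of `A* = A`.
  rw [ContinuousLinearMap.orthogonal_ker, hA.adjoint_eq, ← SetLike.mem_coe,
    Submodule.topologicalClosure_coe, mem_closure_iff_seq_limit] at h
  obtain ⟨y, hy, hyt⟩ := h
  choose x hx using hy
  have hxy : ∀ k, A (x k) = y k := hx
  refine ⟨x, by simpa only [hxy] using hyt, fun g ↦ ?_⟩
  have h1 : ∀ k, inner ℂ (incl A g) (x k) = inner ℂ (preimage A g) (y k) := fun k ↦ by
    rw [← apply_preimage, ← hxy]
    exact hA.isSymmetric _ _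
  simp only [h1]
  exact tendsto_const_nhds.inner hyt

end RangeSpace

/-! ### Schwarz–Pick and the weights `1 - |b|²` and `1 - |z|²` -/

namespace Bergman

/-- A consequence of the Schwarz–Pick lemma. -/
theorem InUnitBallHInf.exists_one_sub_norm_sq_le {b : ℂ → ℂ} (hb : InUnitBallHInf b)
    (hc : ¬ ∃ c : ℂ, ‖c‖ = 1 ∧ ∀ z ∈ ball (0 : ℂ) 1, b z = c) :
    ∃ C : ℝ, 0 < C ∧ ∀ z ∈ ball (0 : ℂ) 1, 1 - ‖z‖ ^ 2 ≤ C ^ 2 * (1 - ‖b z‖ ^ 2) := by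
  have h0 : (0 : ℂ) ∈ ball (0 : ℂ) 1 := mem_ball_self one_pos
  set a := b 0 with ha
  have ha1 : ‖a‖ < 1 := by
    refine lt_of_le_of_ne (hb.norm_le_one 0 h0) fun h ↦ hc ⟨a, h, fun z hz ↦ ?_⟩
    refine Complex.eqOn_of_isPreconnected_of_isMaxOn_norm
      (convex_ball (0 : ℂ) 1).isPreconnected isOpen_ball hb.differentiableOn h0 ?_ hz
    intro w hw
    change ‖b w‖ ≤ ‖b 0‖
    rw [← ha, h]
    exact hb.norm_le_one w hw
  have hden : ∀ z ∈ ball (0 : ℂ) 1, 1 - ‖a‖ ≤ ‖1 - starRingEnd ℂ a * b z‖ := fun z hz ↦ by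
    have h1 := norm_sub_norm_le (1 : ℂ) (starRingEnd ℂ a * b z)
    rw [norm_one, norm_mul, RCLike.norm_conj] at h1
    nlinarith [norm_nonneg a, hb.norm_le_one z hz]
  have hden0 : ∀ z ∈ ball (0 : ℂ) 1, 1 - starRingEnd ℂ a * b z ≠ 0 := fun z hz h ↦ by
    have := hden z hz
    rw [h, norm_zero] at this
    linarith
  have hid : ∀ w : ℂ, ‖1 - starRingEnd ℂ a * w‖ ^ 2 - ‖w - a‖ ^ 2 =
      (1 - ‖a‖ ^ 2) * (1 - ‖w‖ ^ 2) := fun w ↦ by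
    simp only [← Complex.normSq_eq_norm_sq, Complex.normSq_apply, Complex.sub_re, Complex.sub_im,
      Complex.mul_re, Complex.mul_im, Complex.conj_re, Complex.conj_im, Complex.one_re,
      Complex.one_im]
    ring
  have ha2 : 0 < 1 - ‖a‖ ^ 2 := by nlinarith [norm_nonneg a]
  -- Schwarz's lemma for `b` followed by the disk automorphism that sends `a` to `0`.
  have hφ : ∀ z ∈ ball (0 : ℂ) 1, ‖(b z - a) / (1 - starRingEnd ℂ a * b z)‖ ≤ ‖z‖ := by
    intro z hz
    refine Complex.norm_le_norm_of_mapsTo_ball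
      (f := fun z ↦ (b z - a) / (1 - starRingEnd ℂ a * b z)) (R := 1) ?_ ?_ ?_ (by simpa using hz)
    · exact (hb.differentiableOn.sub_const a).div
        ((hb.differentiableOn.const_mul _).const_sub 1) hden0
    · intro w hw
      rw [mem_closedBall_zero_iff, norm_div, div_le_one (norm_pos_iff.2 (hden0 w hw))]
      refine abs_le_of_sq_le_sq' ?_ (norm_nonneg _) |>.2
      have h1 : 0 ≤ 1 - ‖b w‖ ^ 2 := by nlinarith [norm_nonneg (b w), hb.norm_le_one w hw]
      nlinarith [hid (b w), mul_nonneg ha2.le h1]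
    · simp [← ha]
  -- With `D = |1 - ā b|`, one has `1 - |z|² ≤ (1 - |a|²)(1 - |b|²) / D²`, where `D ≥ 1 - |a|` and
  -- `1 - |a|² ≤ 1`.
  refine ⟨(1 - ‖a‖)⁻¹, by rw [inv_pos]; linarith, fun z hz ↦ ?_⟩
  have h1 := hφ z hz
  have hz1 : ‖z‖ < 1 := by simpa using hz
  rw [norm_div, div_le_iff₀ (norm_pos_iff.2 (hden0 z hz))] at h1
  have h2 := hid (b z)
  have h3 := hden z hz
  set D := ‖1 - starRingEnd ℂ a * b z‖
  have h4 : ‖b z - a‖ ^ 2 ≤ (‖z‖ * D) ^ 2 := pow_le_pow_left₀ (norm_nonneg _) h1 2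
  have h5 : (1 - ‖a‖) ^ 2 ≤ D ^ 2 := pow_le_pow_left₀ (by linarith) h3 2
  have h6 : 0 ≤ 1 - ‖z‖ ^ 2 := by nlinarith [norm_nonneg z]
  have h7 : 0 ≤ 1 - ‖b z‖ ^ 2 := by nlinarith [norm_nonneg (b z), hb.norm_le_one z hz]
  rw [inv_pow, inv_mul_eq_div, le_div_iff₀ (by nlinarith)]
  nlinarith [mul_le_mul_of_nonneg_left h5 h6, mul_nonneg (sq_nonneg ‖a‖) h7]

/-- The function `(1 - |b|²)^{1/2}`. -/
def defectWeight (b : ℂ → ℂ) (z : ℂ) : ℂ := ((√(1 - ‖b z‖ ^ 2) : ℝ) : ℂ)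

theorem norm_defectWeight (b : ℂ → ℂ) (z : ℂ) : ‖defectWeight b z‖ = √(1 - ‖b z‖ ^ 2) := by
  rw [defectWeight, Complex.norm_real, Real.norm_eq_abs, abs_of_nonneg (Real.sqrt_nonneg _)]

theorem InUnitBallHInf.memLp_defectWeight {b : ℂ → ℂ} (hb : InUnitBallHInf b) :
    MemLp (defectWeight b) ∞ areaMeasure := by
  have hcont : ContinuousOn (defectWeight b) (ball 0 1) :=
    Complex.continuous_ofReal.comp_continuousOn
      (Real.continuous_sqrt.comp_continuousOn
        (continuousOn_const.sub (hb.differentiableOn.continuousOn.norm.pow 2)))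
  refine memLp_top_of_bound (aestronglyMeasurable_of_continuousOn hcont) 1
    (Eventually.of_forall fun z ↦ ?_)
  rw [norm_defectWeight]
  exact Real.sqrt_le_one.2 (by nlinarith [sq_nonneg ‖b z‖])

/-- Multiplication by `(1 - |b|²)^{1/2}` on `L²(𝔻, dA)`. -/
def InUnitBallHInf.mulDefect {b : ℂ → ℂ} (hb : InUnitBallHInf b) :
    Lp ℂ 2 areaMeasure →L[ℂ] Lp ℂ 2 areaMeasure :=
  mulLp (hb.memLp_defectWeight.toLp _)

theorem InUnitBallHInf.coeFn_mulDefect {b : ℂ → ℂ} (hb : InUnitBallHInf b)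
    (f : Lp ℂ 2 areaMeasure) : hb.mulDefect f =ᵐ[areaMeasure] fun z ↦ defectWeight b z * f z := by
  filter_upwards [coeFn_mulLp (hb.memLp_defectWeight.toLp _) f,
    hb.memLp_defectWeight.coeFn_toLp] with z h1 h2
  rw [mulDefect, h1, h2]

theorem InUnitBallHInf.inner_mulDefect {b : ℂ → ℂ} (hb : InUnitBallHInf b)
    (f g : Lp ℂ 2 areaMeasure) :
    inner ℂ (hb.mulDefect f) (hb.mulDefect g) =
      inner ℂ f g - inner ℂ (mulLp hb.symbol f) (mulLp hb.symbol g) := by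
  rw [L2.inner_def, L2.inner_def, L2.inner_def,
    ← integral_sub (L2.integrable_inner f g) (L2.integrable_inner _ _)]
  refine integral_congr_ae ?_
  filter_upwards [hb.coeFn_mulDefect f, hb.coeFn_mulDefect g, hb.coeFn_mulLp_symbol f,
    hb.coeFn_mulLp_symbol g, ae_mem_ball] with z h1 h2 h3 h4 hz
  rw [h1, h2, h3, h4]
  have h5 : 0 ≤ 1 - ‖b z‖ ^ 2 := by nlinarith [norm_nonneg (b z), hb.norm_le_one z hz]
  have h6 : defectWeight b z * starRingEnd ℂ (defectWeight b z) =
      1 - b z * starRingEnd ℂ (b z) := by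
    rw [defectWeight, Complex.conj_ofReal, ← Complex.ofReal_mul, Real.mul_self_sqrt h5,
      Complex.mul_conj, Complex.normSq_eq_norm_sq]
    push_cast
    ring
  simp only [RCLike.inner_apply, map_mul]
  linear_combination (g z * starRingEnd ℂ (f z)) * h6

theorem InUnitBallHInf.norm_mulDefect_sq {b : ℂ → ℂ} (hb : InUnitBallHInf b) (h : A2) :
    ‖hb.mulDefect h‖ ^ 2 = ‖h‖ ^ 2 - ‖toeplitz hb.symbol h‖ ^ 2 := by
  have h1 := congrArg Complex.re (hb.inner_mulDefect h h)
  rw [Complex.sub_re] at h1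
  have h2 : ∀ f : Lp ℂ 2 areaMeasure, (inner ℂ f f).re = ‖f‖ ^ 2 := fun f ↦
    inner_self_eq_norm_sq (𝕜 := ℂ) f
  rw [h2, h2, h2, ← hb.coe_toeplitz] at h1
  exact h1

theorem InUnitBallHInf.mulDefect_comm {b c : ℂ → ℂ} (hb : InUnitBallHInf b)
    (hc : InUnitBallHInf c) (f : Lp ℂ 2 areaMeasure) :
    hb.mulDefect (hc.mulDefect f) = hc.mulDefect (hb.mulDefect f) := by
  apply Lp.ext
  filter_upwards [hb.coeFn_mulDefect (hc.mulDefect f), hc.coeFn_mulDefect (hb.mulDefect f),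
    hb.coeFn_mulDefect f, hc.coeFn_mulDefect f] with z h1 h2 h3 h4
  rw [h1, h2, h3, h4]
  ring

theorem eq_zero_of_mulDefect_id {f : Lp ℂ 2 areaMeasure}
    (h : inUnitBallHInf_id.mulDefect f = 0) : f = 0 := by
  apply Lp.ext
  have h0 := inUnitBallHInf_id.coeFn_mulDefect f
  rw [h] at h0
  filter_upwards [h0, Lp.coeFn_zero ℂ 2 areaMeasure, ae_mem_ball] with z h1 h2 hz
  rw [h2] at h1 ⊢
  refine (mul_eq_zero.1 h1.symm).resolve_left ?_
  rw [← norm_eq_zero, norm_defectWeight]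
  have : ‖z‖ < 1 := by simpa using hz
  exact (Real.sqrt_pos.2 (by nlinarith [norm_nonneg z])).ne'

theorem InUnitBallHInf.norm_mulDefect_id_le {b : ℂ → ℂ} (hb : InUnitBallHInf b) {C : ℝ}
    (hC0 : 0 < C) (hC : ∀ z ∈ ball (0 : ℂ) 1, 1 - ‖z‖ ^ 2 ≤ C ^ 2 * (1 - ‖b z‖ ^ 2))
    (f : Lp ℂ 2 areaMeasure) :
    ‖inUnitBallHInf_id.mulDefect f‖ ≤ C * ‖hb.mulDefect f‖ := by
  refine Lp.norm_le_mul_norm_of_ae_le_mul ?_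
  filter_upwards [inUnitBallHInf_id.coeFn_mulDefect f, hb.coeFn_mulDefect f, ae_mem_ball]
    with z h1 h2 hz
  rw [h1, h2, norm_mul, norm_mul, norm_defectWeight, norm_defectWeight, ← mul_assoc]
  gcongr
  calc _ ≤ √(C ^ 2 * (1 - ‖b z‖ ^ 2)) := Real.sqrt_le_sqrt (hC z hz)
    _ = C * √(1 - ‖b z‖ ^ 2) := by rw [Real.sqrt_mul (sq_nonneg C), Real.sqrt_sq hC0.le]

/-- The adjoint shift sends `z ^ (n + 1)` to a multiple of `z ^ n`; the factor is the ratio of the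
squared norms `1 / (n + 2)` and `1 / (n + 1)`. -/
theorem inner_monomial_succ_shift (n : ℕ) (h : A2) :
    inner ℂ (monomial (n + 1)) (shift h) =
      ((n : ℂ) + 1) / (n + 2) * inner ℂ (monomial n) h := by
  have h1 : shift.adjoint (monomial (n + 1)) = (((n : ℂ) + 1) / (n + 2)) • monomial n := by
    rw [← sub_eq_zero]
    refine eq_zero_of_forall_inner_monomial fun m ↦ ?_
    rw [inner_sub_right, ContinuousLinearMap.adjoint_inner_right, shift_monomial, inner_smul_right,
      inner_monomial, inner_monomial]
    have h3 : ((n : ℂ) + 2) ≠ 0 := by exact_mod_cast (by omega : n + 2 ≠ 0)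
    have h4 : ((n : ℂ) + 1) ≠ 0 := by exact_mod_cast (by omega : n + 1 ≠ 0)
    by_cases hmn : m = n
    · subst hmn
      simp only [if_true]
      push_cast
      rw [show (m : ℂ) + 1 + 1 = m + 2 by ring]
      field_simp
      ring
    · simp [hmn]
  rw [← ContinuousLinearMap.adjoint_inner_left, h1, inner_smul_left, map_div₀, map_add, map_add,
    map_natCast, map_one, map_ofNat]

/-- The factor is `1 - (n + 1) / (n + 2)`. Being nonzero, it makes the pairings with `z ^ n` in `A²`
and in the weight `1 - |z|²` interchangeable. -/
theorem inner_mulDefect_id_monomial (n : ℕ) (h : A2) :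
    inner ℂ (inUnitBallHInf_id.mulDefect (monomial n)) (inUnitBallHInf_id.mulDefect h) =
      1 / ((n : ℂ) + 2) * inner ℂ (monomial n) h := by
  rw [inUnitBallHInf_id.inner_mulDefect, ← inUnitBallHInf_id.coe_toeplitz,
    ← inUnitBallHInf_id.coe_toeplitz]
  change inner ℂ (monomial n) h - inner ℂ (shift (monomial n)) (shift h) = _
  rw [shift_monomial, inner_monomial_succ_shift]
  have h3 : ((n : ℂ) + 2) ≠ 0 := by exact_mod_cast (by omega : n + 2 ≠ 0)
  field_simp
  ring

/-- The limit `v` lies in the closure of the range of `N`, while `N* v` is orthogonal to all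
monomials and so is zero; hence `v` is orthogonal to itself. -/
theorem eq_zero_of_mem_closure_of_inner_mulDefect_id {v : Lp ℂ 2 areaMeasure} {h : ℕ → A2}
    (hv : Tendsto (fun k ↦ inUnitBallHInf_id.mulDefect (h k)) atTop (𝓝 v))
    (h0 : ∀ n, Tendsto (fun k ↦ inner ℂ (monomial n) (h k)) atTop (𝓝 0)) : v = 0 := by
  set N : A2 →L[ℂ] Lp ℂ 2 areaMeasure := inUnitBallHInf_id.mulDefect ∘L A2.subtypeL with hN
  have hN' : ∀ g : A2, N g = inUnitBallHInf_id.mulDefect g := fun g ↦ rfl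
  have h1 : N.adjoint v = 0 := by
    refine eq_zero_of_forall_inner_monomial fun n ↦ ?_
    rw [ContinuousLinearMap.adjoint_inner_right]
    have h2 := (tendsto_const_nhds (x := N (monomial n))).inner (𝕜 := ℂ) hv
    simp only [hN', inner_mulDefect_id_monomial] at h2
    have h3 := (h0 n).const_mul (1 / ((n : ℂ) + 2))
    rw [mul_zero] at h3
    exact tendsto_nhds_unique h2 h3
  have h2 := hv.inner (𝕜 := ℂ) (tendsto_const_nhds (x := v))
  have h3 : ∀ k, inner ℂ (inUnitBallHInf_id.mulDefect (h k)) v = 0 := fun k ↦ by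
    rw [← hN', ← ContinuousLinearMap.adjoint_inner_right, h1, inner_zero_right]
  simp only [h3] at h2
  exact inner_self_eq_zero.1 (tendsto_nhds_unique h2 tendsto_const_nhds)

/-! ### Comparison of the two sub-Bergman spaces -/

theorem InUnitBallHInf.norm_defectRoot_sq {b : ℂ → ℂ} (hb : InUnitBallHInf b) (h : A2) :
    ‖defectRoot hb.symbol h‖ ^ 2 = ‖h‖ ^ 2 - ‖(toeplitz hb.symbol).adjoint h‖ ^ 2 := by
  rw [defectRoot, toeplitz_star]
  exact norm_positiveSqrt_one_sub_mul_adjoint_sq hb.norm_toeplitz_le h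

theorem InUnitBallHInf.norm_defectRoot_star_sq {b : ℂ → ℂ} (hb : InUnitBallHInf b) (h : A2) :
    ‖defectRoot (star hb.symbol) h‖ ^ 2 = ‖h‖ ^ 2 - ‖toeplitz hb.symbol h‖ ^ 2 := by
  have h1 := norm_positiveSqrt_one_sub_mul_adjoint_sq (S := (toeplitz hb.symbol).adjoint)
    ((LinearIsometryEquiv.norm_map _ _).trans_le hb.norm_toeplitz_le) h
  rw [ContinuousLinearMap.adjoint_adjoint] at h1
  rw [defectRoot, star_star, toeplitz_star]
  exact h1

/-- Since `T_b` is plain multiplication, the defect norm for `b̄` is a weighted `L²` norm. For `b`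
the projection intervenes, which is why density is first proved for `b̄`. -/
theorem InUnitBallHInf.norm_defectRoot_star_eq {b : ℂ → ℂ} (hb : InUnitBallHInf b) (h : A2) :
    ‖defectRoot (star hb.symbol) h‖ = ‖hb.mulDefect h‖ := by
  rw [← sq_eq_sq₀ (norm_nonneg _) (norm_nonneg _), hb.norm_defectRoot_star_sq,
    hb.norm_mulDefect_sq]

theorem isSelfAdjoint_defectRoot (u : Lp ℂ ∞ areaMeasure) : IsSelfAdjoint (defectRoot u) :=
  isSelfAdjoint_positiveSqrt _

theorem InUnitBallHInf.norm_defectRoot_star_le {b : ℂ → ℂ} (hb : InUnitBallHInf b) (h : A2) :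
    ‖defectRoot (star hb.symbol) h‖ ≤ 1 * ‖defectRoot hb.symbol h‖ := by
  rw [one_mul, ← sq_le_sq₀ (norm_nonneg _) (norm_nonneg _), hb.norm_defectRoot_star_sq,
    hb.norm_defectRoot_sq]
  have := pow_le_pow_left₀ (norm_nonneg _) (hb.norm_adjoint_toeplitz_apply_le h) 2
  linarith

theorem InUnitBallHInf.norm_defectRoot_le {b : ℂ → ℂ} (hb : InUnitBallHInf b) (h : A2) :
    ‖defectRoot hb.symbol h‖ ≤ √2 * ‖defectRoot (star hb.symbol) h‖ := by
  rw [← sq_le_sq₀ (norm_nonneg _) (by positivity), mul_pow, Real.sq_sqrt zero_le_two,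
    hb.norm_defectRoot_star_sq, hb.norm_defectRoot_sq]
  linarith [hb.two_mul_norm_toeplitz_sq_le h]

/-- `𝓐(b̄)` is contractively contained in `𝓐(b)`. -/
theorem InUnitBallHInf.exists_incl_eq_of_star {b : ℂ → ℂ} (hb : InUnitBallHInf b)
    (g : SubBergman (star hb.symbol)) :
    ∃ f : SubBergman hb.symbol,
      SubBergman.incl hb.symbol f = SubBergman.incl (star hb.symbol) g ∧ ‖f‖ ≤ ‖g‖ := by
  simpa using RangeSpace.exists_incl_eq (isSelfAdjoint_defectRoot _) (isSelfAdjoint_defectRoot _)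
    zero_le_one hb.norm_defectRoot_star_le g

/-- `𝓐(b)` is contained in `𝓐(b̄)`, with norm at most `√2`. -/
theorem InUnitBallHInf.exists_star_incl_eq {b : ℂ → ℂ} (hb : InUnitBallHInf b)
    (f : SubBergman hb.symbol) :
    ∃ g : SubBergman (star hb.symbol),
      SubBergman.incl (star hb.symbol) g = SubBergman.incl hb.symbol f ∧ ‖g‖ ≤ √2 * ‖f‖ :=
  RangeSpace.exists_incl_eq (isSelfAdjoint_defectRoot _) (isSelfAdjoint_defectRoot _)
    (Real.sqrt_nonneg 2) hb.norm_defectRoot_le f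

/-- Pairing with `z ^ n` is `n + 2` times its pairing in the weight `1 - |z|²`, which Schwarz–Pick
bounds by the defect norm; Douglas' lemma then yields a preimage. -/
theorem InUnitBallHInf.exists_incl_star_eq_monomial {b : ℂ → ℂ} (hb : InUnitBallHInf b) {C : ℝ}
    (hC0 : 0 < C) (hC : ∀ z ∈ ball (0 : ℂ) 1, 1 - ‖z‖ ^ 2 ≤ C ^ 2 * (1 - ‖b z‖ ^ 2)) (n : ℕ) :
    ∃ f : SubBergman (star hb.symbol), SubBergman.incl (star hb.symbol) f = monomial n := by
  set c : ℝ := ‖inUnitBallHInf_id.mulDefect (monomial n)‖ with hc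
  obtain ⟨y, -, -, hy⟩ := exists_apply_eq_of_norm_inner_le
    (isSelfAdjoint_defectRoot (star hb.symbol)) (monomial n) (K := ((n : ℝ) + 2) * (c * C))
    (by positivity) fun x ↦ by
      have h3 : ((n : ℂ) + 2) ≠ 0 := by exact_mod_cast (by omega : n + 2 ≠ 0)
      have h1 : inner ℂ (monomial n) x = ((n : ℂ) + 2) *
          inner ℂ (inUnitBallHInf_id.mulDefect (monomial n)) (inUnitBallHInf_id.mulDefect x) := by
        rw [inner_mulDefect_id_monomial]
        field_simp
      have h2 : ‖(n : ℂ) + 2‖ = (n : ℝ) + 2 := by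
        have : (n : ℂ) + 2 = ((n + 2 : ℕ) : ℂ) := by push_cast; ring
        rw [this, Complex.norm_natCast]
        push_cast
        ring
      rw [h1, norm_mul, h2, mul_assoc]
      gcongr
      calc _ ≤ c * ‖inUnitBallHInf_id.mulDefect x‖ := norm_inner_le_norm _ _
        _ ≤ c * (C * ‖hb.mulDefect x‖) := by gcongr; exact hb.norm_mulDefect_id_le hC0 hC _
        _ = c * C * ‖defectRoot (star hb.symbol) x‖ := by
          rw [hb.norm_defectRoot_star_eq, mul_assoc]
  exact ⟨RangeSpace.map _ y, hy⟩

/-- An element of `𝓐(b̄)` that is orthogonal to all monomials is zero. -/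
theorem InUnitBallHInf.eq_zero_of_forall_inner_eq_zero {b : ℂ → ℂ} (hb : InUnitBallHInf b) {C : ℝ}
    (hC0 : 0 < C) (hC : ∀ z ∈ ball (0 : ℂ) 1, 1 - ‖z‖ ^ 2 ≤ C ^ 2 * (1 - ‖b z‖ ^ 2))
    {e : ℕ → SubBergman (star hb.symbol)}
    (he : ∀ n, SubBergman.incl (star hb.symbol) (e n) = monomial n)
    {f : SubBergman (star hb.symbol)} (hf : ∀ n, inner ℂ (e n) f = 0) : f = 0 := by
  set B := defectRoot (star hb.symbol)
  set M := hb.mulDefect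
  set N := inUnitBallHInf_id.mulDefect
  obtain ⟨h, hh, hin⟩ := RangeSpace.exists_seq_tendsto_preimage
    (isSelfAdjoint_defectRoot (star hb.symbol)) f
  have h0 : ∀ n, Tendsto (fun k ↦ inner ℂ (monomial n) (h k)) atTop (𝓝 0) := fun n ↦ by
    rw [← hf n, ← he n]
    exact hin (e n)
  -- The `h k` themselves need not converge in `A²`; only their weighted versions do.
  have hcM : CauchySeq fun k ↦ M (h k) := by
    have hcB := hh.cauchySeq
    rw [Metric.cauchySeq_iff] at hcB ⊢
    intro ε hε
    obtain ⟨K, hK⟩ := hcB ε hε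
    refine ⟨K, fun m hm n hn ↦ ?_⟩
    have := hK m hm n hn
    rw [dist_eq_norm, ← map_sub] at this ⊢
    rwa [hb.norm_defectRoot_star_eq] at this
  have hcN : CauchySeq fun k ↦ N (h k) := by
    rw [Metric.cauchySeq_iff] at hcM ⊢
    intro ε hε
    obtain ⟨K, hK⟩ := hcM (ε / C) (by positivity)
    refine ⟨K, fun m hm n hn ↦ ?_⟩
    have h1 := hK m hm n hn
    rw [dist_eq_norm, ← map_sub] at h1 ⊢
    refine (hb.norm_mulDefect_id_le hC0 hC _).trans_lt ?_
    rwa [lt_div_iff₀' hC0] at h1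
  obtain ⟨u, hu⟩ := cauchySeq_tendsto_of_complete hcM
  obtain ⟨v, hv⟩ := cauchySeq_tendsto_of_complete hcN
  have hv0 : v = 0 := eq_zero_of_mem_closure_of_inner_mulDefect_id hv h0
  -- `N u = lim N M h_k = lim M N h_k = M v = 0`, and `N` is injective because its weight is
  -- positive on the disk.
  have hu0 : u = 0 := by
    refine eq_zero_of_mulDefect_id (tendsto_nhds_unique ((N.continuous.tendsto u).comp hu) ?_)
    have h1 := (M.continuous.tendsto v).comp hv
    rw [hv0, map_zero] at h1
    exact h1.congr fun k ↦ hb.mulDefect_comm inUnitBallHInf_id _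
  have h1 : Tendsto (fun k ↦ ‖B (h k)‖) atTop (𝓝 0) := by
    have h2 := hu.norm
    rw [hu0, norm_zero] at h2
    exact h2.congr fun k ↦ (hb.norm_defectRoot_star_eq _).symm
  exact norm_eq_zero.1 (tendsto_nhds_unique hh.norm h1)

/-! ### Density of the polynomials -/

theorem ofPolynomial_add (p q : Polynomial ℂ) :
    ofPolynomial (p + q) = ofPolynomial p + ofPolynomial q := by
  apply Subtype.ext
  apply Lp.ext
  rw [Submodule.coe_add]
  filter_upwards [Lp.coeFn_add (ofPolynomial p : Lp ℂ 2 areaMeasure) (ofPolynomial q),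
    coeFn_ofPolynomial p, coeFn_ofPolynomial q, coeFn_ofPolynomial (p + q)] with z h1 h2 h3 h4
  rw [h1, Pi.add_apply, h2, h3, h4, Polynomial.eval_add]

theorem ofPolynomial_smul (c : ℂ) (p : Polynomial ℂ) :
    ofPolynomial (c • p) = c • ofPolynomial p := by
  apply Subtype.ext
  apply Lp.ext
  rw [Submodule.coe_smul]
  filter_upwards [Lp.coeFn_smul c (ofPolynomial p : Lp ℂ 2 areaMeasure),
    coeFn_ofPolynomial p, coeFn_ofPolynomial (c • p)] with z h1 h2 h3
  rw [h1, Pi.smul_apply, h2, h3, Polynomial.eval_smul]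

/-- The polynomials in a sub-Bergman space. -/
def polynomialSubmodule (u : Lp ℂ ∞ areaMeasure) : Submodule ℂ (SubBergman u) where
  carrier := {f | ∃ p, SubBergman.incl u f = ofPolynomial p}
  add_mem' := by
    rintro f g ⟨p, hp⟩ ⟨q, hq⟩
    exact ⟨p + q, by rw [map_add, hp, hq, ofPolynomial_add]⟩
  zero_mem' := ⟨0, by simpa using (ofPolynomial_smul 0 0).symm⟩
  smul_mem' := by
    rintro c f ⟨p, hp⟩
    exact ⟨c • p, by rw [map_smul, hp, ofPolynomial_smul]⟩

theorem ofPolynomial_mem_range {u : Lp ℂ ∞ areaMeasure}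
    (h : ∀ n, ∃ f : SubBergman u, SubBergman.incl u f = monomial n) (p : Polynomial ℂ) :
    ∃ f : SubBergman u, SubBergman.incl u f = ofPolynomial p := by
  choose e he using h
  exact ⟨∑ k ∈ p.support, p.coeff k • e k, by
    rw [map_sum, ofPolynomial_eq_sum]
    exact Finset.sum_congr rfl fun k _ ↦ by rw [map_smul, he]⟩

theorem InUnitBallHInf.dense_polynomials_star {b : ℂ → ℂ} (hb : InUnitBallHInf b) :
    Dense (polynomialSubmodule (star hb.symbol) : Set (SubBergman (star hb.symbol))) := by
  by_cases hc : ∃ c : ℂ, ‖c‖ = 1 ∧ ∀ z ∈ ball (0 : ℂ) 1, b z = c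
  · obtain ⟨c, hc1, hc⟩ := hc
    -- For a unimodular constant `T_b` is isometric, so the defect root vanishes and every element
    -- is the zero polynomial.
    have hnorm : ∀ h : A2, ‖h‖ ≤ ‖toeplitz hb.symbol h‖ := fun h ↦ by
      refine Lp.norm_le_norm_of_ae_le
        (g := ((toeplitz hb.symbol h : A2) : Lp ℂ 2 areaMeasure)) ?_
      rw [hb.coe_toeplitz]
      filter_upwards [hb.coeFn_mulLp_symbol h, ae_mem_ball] with z h1 h2
      rw [h1, hc z h2, norm_mul, hc1, one_mul]
      exact le_rfl
    refine fun f ↦ subset_closure ⟨0, ?_⟩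
    rw [show ofPolynomial 0 = 0 by simpa using ofPolynomial_smul 0 0,
      ← RangeSpace.apply_preimage, ← norm_eq_zero,
      ← pow_eq_zero_iff two_ne_zero, hb.norm_defectRoot_star_sq]
    have h1 := hnorm (RangeSpace.preimage _ f)
    have h2 := (toeplitz hb.symbol).le_of_opNorm_le hb.norm_toeplitz_le (RangeSpace.preimage _ f)
    rw [one_mul] at h2
    rw [le_antisymm h1 h2, sub_self]
  · obtain ⟨C, hC0, hC⟩ := hb.exists_one_sub_norm_sq_le hc
    choose e he using hb.exists_incl_star_eq_monomial hC0 hC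
    rw [Submodule.dense_iff_topologicalClosure_eq_top, Submodule.topologicalClosure_eq_top_iff,
      Submodule.eq_bot_iff]
    exact fun f hf ↦ hb.eq_zero_of_forall_inner_eq_zero hC0 hC he fun n ↦ hf _ ⟨_, he n⟩

theorem InUnitBallHInf.dense_polynomials {b : ℂ → ℂ} (hb : InUnitBallHInf b) :
    Dense (polynomialSubmodule hb.symbol : Set (SubBergman hb.symbol)) := by
  intro f
  rw [Metric.mem_closure_iff]
  intro ε hε
  obtain ⟨g, hg, -⟩ := hb.exists_star_incl_eq f
  obtain ⟨q, ⟨p, hp⟩, hq⟩ := Metric.mem_closure_iff.1 (hb.dense_polynomials_star g) ε hε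
  -- Transferring the error `g - q` instead of `q` gives the norm bound at once, and `f - d` is then
  -- the polynomial `p`.
  obtain ⟨d, hd, hdn⟩ := hb.exists_incl_eq_of_star (g - q)
  have hd' : SubBergman.incl hb.symbol (f - d) = ofPolynomial p := by
    rw [map_sub, hd, map_sub, hg, hp, sub_sub_cancel]
  refine ⟨f - d, ⟨p, hd'⟩, ?_⟩
  rw [dist_eq_norm, sub_sub_cancel]
  rw [dist_eq_norm] at hq
  exact hdn.trans_lt hq

end Bergman

end

/-- Polynomials are dense in the sub-Bergman spaces `𝓐(b)` and `𝓐(b̄)`, which coincide with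
equivalent norms. Unless `b` is a unimodular constant, when both spaces are zero, they contain all
polynomials. -/
theorem mainTheorem1 (b : ℂ → ℂ) (hb : Bergman.InUnitBallHInf b) :
    Dense {f : Bergman.SubBergman hb.symbol |
      ∃ p : Polynomial ℂ, Bergman.SubBergman.incl hb.symbol f = Bergman.ofPolynomial p} ∧
    Dense {f : Bergman.SubBergman (star hb.symbol) |
      ∃ p : Polynomial ℂ, Bergman.SubBergman.incl (star hb.symbol) f = Bergman.ofPolynomial p} ∧
    ((¬ ∃ c : ℂ, ‖c‖ = 1 ∧ ∀ z ∈ Metric.ball (0 : ℂ) 1, b z = c) →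
      ∀ p : Polynomial ℂ,
        (∃ f : Bergman.SubBergman hb.symbol,
          Bergman.SubBergman.incl hb.symbol f = Bergman.ofPolynomial p) ∧
        (∃ f : Bergman.SubBergman (star hb.symbol),
          Bergman.SubBergman.incl (star hb.symbol) f = Bergman.ofPolynomial p)) ∧
    (Set.range (Bergman.SubBergman.incl hb.symbol) =
      Set.range (Bergman.SubBergman.incl (star hb.symbol)) ∧
    ∀ (f : Bergman.SubBergman hb.symbol) (g : Bergman.SubBergman (star hb.symbol)),
      Bergman.SubBergman.incl hb.symbol f = Bergman.SubBergman.incl (star hb.symbol) g →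
        ‖f‖ ≤ ‖g‖ ∧ ‖g‖ ≤ √2 * ‖f‖) := by
  refine ⟨hb.dense_polynomials, hb.dense_polynomials_star, fun hc p ↦ ?_, ?_, fun f g hfg ↦ ?_⟩
  · obtain ⟨C, hC0, hC⟩ := hb.exists_one_sub_norm_sq_le hc
    obtain ⟨g, hg⟩ := Bergman.ofPolynomial_mem_range (hb.exists_incl_star_eq_monomial hC0 hC) p
    obtain ⟨f, hf, -⟩ := hb.exists_incl_eq_of_star g
    exact ⟨⟨f, hf.trans hg⟩, ⟨g, hg⟩⟩
  · refine Set.Subset.antisymm ?_ ?_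
    · rintro _ ⟨f, rfl⟩
      obtain ⟨g, hg, -⟩ := hb.exists_star_incl_eq f
      exact ⟨g, hg⟩
    · rintro _ ⟨g, rfl⟩
      obtain ⟨f, hf, -⟩ := hb.exists_incl_eq_of_star g
      exact ⟨f, hf⟩
  · obtain ⟨g', hg', hgn⟩ := hb.exists_star_incl_eq f
    obtain ⟨f', hf', hfn⟩ := hb.exists_incl_eq_of_star g
    -- The comparison lemmas only assert existence; injectivity of the inclusions identifies their
    -- witnesses with the given `f` and `g`.
    have h1 : g' = g := RangeSpace.incl_injective _ (hg'.trans hfg)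
    have h2 : f' = f := RangeSpace.incl_injective _ (hf'.trans hfg.symm)
    exact ⟨h2 ▸ hfn, h1 ▸ hgn⟩
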